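/- Let $d\ge 2$, let $n_1,\dots,n_d\ge 1$, and equip $\mathbb{R}^{n_1\times\dots\times n_d}$ with the Frobenius inner product and norm. The TT-rank of a tensor $\boldsymbol X$ is $\boldsymbol r=(r_1,\dots,r_{d-1})$, where $r_k$ is the rank of the $k$-th unfolding $X^{\langle k\rangle}\in\mathbb{R}^{(n_1\cdots n_k)\times(n_{k+1}\cdots n_d)}$; put $r_0=r_d=1$. Let $\mathcal M_{\boldsymbol r}$ be the manifold of tensors of TT-rank $\boldsymbol r$, where all $r_k\ge 1$, and let $\boldsymbol A\in\mathcal M_{\boldsymbol r}$. A TT-representation $\boldsymbol A=[\boldsymbol G_1,\dots,\boldsymbol G_d]$ with cores $\boldsymbol G_k\in\mathbb{R}^{r_{k-1}\times n_k\times r_k}$, whose sizes are given by the TT-rank of $\boldsymbol A$, is called minimal. Choose minimal representations $\boldsymbol A=[\boldsymbol U_1,\dots,\boldsymbol U_{d-1},\boldsymbol G_d]=[\boldsymbol G_1,\boldsymbol V_2,\dots,\boldsymbol V_d]$ in which the left unfoldings of the $\boldsymbol U_k$ have orthonormal columns and the right unfoldings of the $\boldsymbol V_k$ have orthonormal rows.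 The core coherence $\mu_C(\boldsymbol A)$ is the maximum of the numbers $$\frac{r_{k-1}n_k}{r_k}\max_{i\in[n_k]}\|\boldsymbol U_k(:,i,:)\|^2\quad(1\le k\le d-1),\qquad \frac{r_kn_k}{r_{k-1}}\max_{i\in[n_k]}\|\boldsymbol V_k(:,i,:)\|^2\quad(2\le k\le d),$$ where $\|\cdot\|$ is the spectral norm; it does not depend on the representations chosen. Suppose that $\mu_C(\boldsymbol A)\le\mu_1$. Let $\Omega$ be a collection of $|\Omega|$ independent indices, each uniformly distributed on $[n_1]\times\dots\times[n_d]$ (sampling with replacement), let $\mathcal R_\Omega\boldsymbol Z=\sum_{\omega\in\Omega}\boldsymbol Z(\omega)\boldsymbol E_\omega$, with repetitions counted and $\boldsymbol E_\omega$ the canonical basis tensors, and let $\rho=|\Omega|/(n_1\cdots n_d)$. Let $\mathcal P$ be the orthogonal projection onto the tangent space $T_{\boldsymbol A}\mathcal M_{\boldsymbol r}$, and let $n=\max_k n_k$, $r=\max_k r_k$ and $$C_1=\frac{\mu_1^{d-1}}{n_1\cdots n_d}\sum_{k=1}^{d}r_{k-1}n_kr_k .$$ Then for all $0<\varepsilon<1$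 and all $\beta>1$, the restricted isometry property on the tangent space $$\big\|\mathcal P-\rho^{-1}\mathcal P\mathcal R_\Omega\mathcal P\big\|<\varepsilon$$ (in the operator norm induced by the Frobenius norm) holds with probability at least $1-2n^{d(1-\beta)}$ provided that $$\rho\ \ge\ \frac83\,\frac{C_1}{\varepsilon^2}\,d\beta\log n .$$ In particular, it holds with at least this probability provided that $$|\Omega|\ \ge\ \frac{8\beta}{3\varepsilon^2}\,\mu_1^{d-1}d^2r^2n\log n .$$ -/

import Mathlib

open MeasureTheory ProbabilityTheory
open scoped ContDiff Topology

namespace TT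

noncomputable section

/-- Multi-indices `(i₁, …, i_d) ∈ [n₁] × … × [n_d]`. -/
abbrev Index {d : ℕ} (n : Fin d → ℕ) : Type := (k : Fin d) → Fin (n k)

/-- The space `ℝ^{n₁ × … × n_d}` of tensors with the Frobenius inner product and norm. -/
abbrev Tensor {d : ℕ} (n : Fin d → ℕ) : Type := EuclideanSpace ℝ (Index n)

/-- The `k`-th unfolding: the matrix whose rows are indexed by the first `k` indices and whose
columns are indexed by the remaining ones. -/
def unfolding {d : ℕ} {n : Fin d → ℕ} (X : Tensor n) (k : ℕ) :
    Matrix ((j : {j : Fin d // (j : ℕ) < k}) → Fin (n j))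
      ((j : {j : Fin d // ¬ (j : ℕ) < k}) → Fin (n j)) ℝ :=
  Matrix.of fun a b =>
    X ((Equiv.piEquivPiSubtypeProd (fun j : Fin d => (j : ℕ) < k) (fun j => Fin (n j))).symm (a, b))

/-- The TT-rank `(r₀, r₁, …, r_d)`: `r_k` is the rank of the `k`-th unfolding for `0 < k < d`,
and `r₀ = r_d = 1` by convention. -/
def ttRank {d : ℕ} {n : Fin d → ℕ} (X : Tensor n) : Fin (d + 1) → ℕ := fun k =>
  if k = 0 ∨ k = Fin.last d then 1 else (unfolding X (k : ℕ)).rank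

/-- The set `M_r` of all tensors of TT-rank `r`. -/
def manifold {d : ℕ} (n : Fin d → ℕ) (r : Fin (d + 1) → ℕ) : Set (Tensor n) :=
  {X | ttRank X = r}

/-- The tangent space at `x` of a submanifold `M` of a normed space: the span of the velocities at
time `0` of smooth curves in `M` that pass through `x` at time `0` (for an embedded submanifold
these velocities already form a subspace). -/
def tangentSpaceAt {E : Type*} [NormedAddCommGroup E] [NormedSpace ℝ E] (M : Set E) (x : E) :
    Submodule ℝ E :=
  Submodule.span ℝ {v | ∃ γ : ℝ → E, ContDiffAt ℝ ∞ γ 0 ∧ γ 0 = x ∧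
    (∀ᶠ t in 𝓝 (0 : ℝ), γ t ∈ M) ∧ HasDerivAt γ v 0}

/-- A three-dimensional tensor in `ℝ^{r × m × s}`, stored through its slices: `G i` is the
`r × s` matrix `G(:, i, :)`. -/
abbrev Core (r m s : ℕ) : Type := Fin m → Matrix (Fin r) (Fin s) ℝ

/-- The left unfolding `G^L ∈ ℝ^{r m × s}`. -/
def leftUnfolding {r m s : ℕ} (G : Core r m s) : Matrix (Fin r × Fin m) (Fin s) ℝ :=
  Matrix.of fun p b => G p.2 p.1 b

/-- The right unfolding `G^R ∈ ℝ^{r × m s}`. -/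
def rightUnfolding {r m s : ℕ} (G : Core r m s) : Matrix (Fin r) (Fin m × Fin s) ℝ :=
  Matrix.of fun a p => G p.1 a p.2

def IsLeftOrthogonal {r m s : ℕ} (G : Core r m s) : Prop :=
  (leftUnfolding G).transpose * leftUnfolding G = 1

def IsRightOrthogonal {r m s : ℕ} (G : Core r m s) : Prop :=
  rightUnfolding G * (rightUnfolding G).transpose = 1

/-- TT-cores with ranks `r`: the `k`-th core lies in `ℝ^{r_{k-1} × n_k × r_k}`. -/
abbrev Cores {d : ℕ} (n : Fin d → ℕ) (r : Fin (d + 1) → ℕ) : Type :=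
  (k : Fin d) → Core (r k.castSucc) (n k) (r k.succ)

/-- The tensor `[G₁, …, G_d]`, with entries
`∑_α G₁(α₀, i₁, α₁) G₂(α₁, i₂, α₂) ⋯ G_d(α_{d-1}, i_d, α_d)`. -/
def ofCores {d : ℕ} {n : Fin d → ℕ} {r : Fin (d + 1) → ℕ} (G : Cores n r) : Tensor n :=
  WithLp.toLp 2 fun i =>
    ∑ α : (k : Fin (d + 1)) → Fin (r k), ∏ k : Fin d, G k (i k) (α k.castSucc) (α k.succ)

/-- `X = [U₁, …, U_{d-1}, G_d]` is a left-orthogonal TT-representation that is minimal, i.e. its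
ranks are those of `X`. -/
def IsMinimalLeftOrthogonal {d : ℕ} {n : Fin d → ℕ} (X : Tensor n) (G : Cores n (ttRank X)) :
    Prop :=
  ofCores G = X ∧ ∀ k : Fin d, k.succ ≠ Fin.last d → IsLeftOrthogonal (G k)

/-- `X = [G₁, V₂, …, V_d]` is a right-orthogonal TT-representation that is minimal, i.e. its
ranks are those of `X`. -/
def IsMinimalRightOrthogonal {d : ℕ} {n : Fin d → ℕ} (X : Tensor n) (G : Cores n (ttRank X)) :
    Prop :=
  ofCores G = X ∧ ∀ k : Fin d, k.castSucc ≠ 0 → IsRightOrthogonal (G k)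

section SpectralNorm

open scoped Matrix.Norms.L2Operator

/-- The left coherence `(r m / s) max_i ‖U^{(i)}‖²`, with the spectral norm of the slices. -/
def leftCoherence {r m s : ℕ} (U : Core r m s) : ℝ :=
  ((r : ℝ) * m / s) * ⨆ i : Fin m, ‖U i‖ ^ 2

/-- The right coherence `(s m / r) max_i ‖V^{(i)}‖²`, with the spectral norm of the slices
`V^{(i)} = V(:, i, :)ᵀ`. -/
def rightCoherence {r m s : ℕ} (V : Core r m s) : ℝ :=
  ((s : ℝ) * m / r) * ⨆ i : Fin m, ‖(V i).transpose‖ ^ 2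

end SpectralNorm

/-- The core coherence `μ_C(X)`: the maximum of the left coherences of the cores `U₁, …, U_{d-1}`
of a minimal left-orthogonal representation and of the right coherences of the cores
`V₂, …, V_d` of a minimal right-orthogonal one. The coherences do not depend on the choice of the
representations; the supremum is over all choices. -/
def coreCoherence {d : ℕ} {n : Fin d → ℕ} (X : Tensor n) : ℝ :=
  sSup ({c | ∃ U : Cores n (ttRank X), IsMinimalLeftOrthogonal X U ∧
          ∃ k : Fin d, k.succ ≠ Fin.last d ∧ c = leftCoherence (U k)} ∪
        {c | ∃ V : Cores n (ttRank X), IsMinimalRightOrthogonal X V ∧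
          ∃ k : Fin d, k.castSucc ≠ 0 ∧ c = rightCoherence (V k)})

/-- The sampling operator `R_Ω Z = ∑_{ω ∈ Ω} Z(ω) E_ω`, repetitions being counted. -/
def samplingOp {d : ℕ} {n : Fin d → ℕ} {K : ℕ} (w : Fin K → Index n) :
    Tensor n →L[ℝ] Tensor n :=
  ∑ j : Fin K, (EuclideanSpace.proj (w j) : Tensor n →L[ℝ] ℝ).smulRight
    (EuclideanSpace.single (w j) (1 : ℝ))

/-- The number `n₁ ⋯ n_d` of entries, as a real number. -/
def numEntries {d : ℕ} (n : Fin d → ℕ) : ℝ := ∏ k : Fin d, (n k : ℝ)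

/-- The sampling density `ρ = |Ω| / (n₁ ⋯ n_d)` of a sample of size `K`. -/
def density {d : ℕ} (n : Fin d → ℕ) (K : ℕ) : ℝ := (K : ℝ) / numEntries n

/-- RIP with constant `ε` on a subspace `T`: `‖P_T - ρ⁻¹ P_T R_Ω P_T‖ < ε`. -/
def RIPOn {d : ℕ} {n : Fin d → ℕ} {K : ℕ} (w : Fin K → Index n) (T : Submodule ℝ (Tensor n))
    (ε : ℝ) : Prop :=
  ‖T.starProjection - (density n K)⁻¹ •
    (T.starProjection ∘L samplingOp w ∘L T.starProjection)‖ < ε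

/-- `C₁ = μ₁^{d-1} / (n₁ ⋯ n_d) · ∑_k r_{k-1} n_k r_k`. -/
def C₁ {d : ℕ} (n : Fin d → ℕ) (r : Fin (d + 1) → ℕ) (μ₁ : ℝ) : ℝ :=
  μ₁ ^ (d - 1) / numEntries n *
    ∑ k : Fin d, (r k.castSucc : ℝ) * (n k : ℝ) * (r k.succ : ℝ)

/-- `n = max (n₁, …, n_d)`. -/
def maxSize {d : ℕ} (n : Fin d → ℕ) : ℕ := Finset.univ.sup n

/-- `r = max (r₁, …, r_{d-1})`; as the ranks are positive, `r₀ = r_d = 1` do not matter. -/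
def maxRank {d : ℕ} (r : Fin (d + 1) → ℕ) : ℕ := Finset.univ.sup r

end

end TT

/-! The theorem combines a matrix Chernoff bound with an estimate of one number: an L such that
v(e)² ≤ L‖v‖² for every v in the tangent space T and every entry e.

Probability. In an orthonormal basis of T, the operator P R_Ω P restricted to T is a sum of
independent rank-one matrices a aᵀ, where a holds the coordinates of the projection of a random E_ω.
Here |a|² ≤ L, and summing a aᵀ over all ω gives the identity.
`exists_card_le_forall_eigenvalues_lt` confines the eigenvalues of the sum to (1 ± ε)ρ, following
Ahlswede and Winter: Golden–Thompson (`trace_exp_add_le`) peels one sample at a time off a trace of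
exponentials. Expectations appear as sums over all sample sequences, and the count of bad sequences
is turned into a probability only at the end.

Geometry. L = C₁ is admissible (`sq_apply_le_C₁_mul`). Let Q_k project the columns of the k-th
unfolding onto the column space of that unfolding of A, and let R_k do the same for rows. A velocity
v of a curve of constant rank satisfies (1 - Q_k)(1 - R_k)v = 0. The Q_k are decreasing, so v is the
orthogonal sum of the pieces (Q_k - Q_{k+1})v, and the equation makes each piece a fixed point of
R_{k+1} as well as of Q_k. On such fixed points the evaluation at e is bounded by a product of two
leverage scores: at most μ₁^k r_k/(n₁⋯n_k) on the left, and at most μ₁^(d-k-1) r_{k+1}/(n_{k+2}⋯n_d)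
on the right. The scores are obtained by passing through the orthogonal cores one by one, each
costing a factor μ₁. The products add up to C₁, and Cauchy–Schwarz over the pieces concludes. Only
necessary linear conditions on T are used, never its dimension or an explicit parametrization. -/

namespace TT

/-! ### The Lie–Trotter product formula -/

section LieTrotter

open Filter NormedSpace

variable {𝔸 : Type*} [NormedRing 𝔸] [NormedAlgebra ℝ 𝔸] [CompleteSpace 𝔸] [NormOneClass 𝔸]

lemma norm_exp_le_exp_norm (x : 𝔸) : ‖exp x‖ ≤ Real.exp ‖x‖ := by
  have h := exp_series_hasSum_exp' (𝕂 := ℝ) x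
  have h' := exp_series_hasSum_exp' (𝕂 := ℝ) ‖x‖
  rw [← Real.exp_eq_exp_ℝ] at h'
  rw [← h.tsum_eq]
  refine tsum_of_norm_bounded h' fun n => ?_
  rw [norm_smul, smul_eq_mul, norm_inv, Real.norm_natCast]
  gcongr
  exact norm_pow_le x n

omit [NormedAlgebra ℝ 𝔸] [CompleteSpace 𝔸] in
lemma norm_pow_sub_pow_le {x y : 𝔸} {c : ℝ} (hc : 1 ≤ c) (hx : ‖x‖ ≤ c) (hy : ‖y‖ ≤ c) (m : ℕ) :
    ‖x ^ m - y ^ m‖ ≤ m * c ^ m * ‖x - y‖ := by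
  induction m with
  | zero => simp
  | succ m ih =>
    have h : x ^ (m + 1) - y ^ (m + 1) = x ^ m * (x - y) + (x ^ m - y ^ m) * y := by
      rw [pow_succ, pow_succ]; noncomm_ring
    have hc0 : 0 ≤ c := by linarith
    have h1 : ‖x ^ m‖ ≤ c ^ (m + 1) := by
      calc ‖x ^ m‖ ≤ ‖x‖ ^ m := norm_pow_le x m
        _ ≤ c ^ m := by gcongr
        _ ≤ c ^ (m + 1) := pow_le_pow_right₀ hc (Nat.le_succ m)
    calc ‖x ^ (m + 1) - y ^ (m + 1)‖ ≤ ‖x ^ m‖ * ‖x - y‖ + ‖x ^ m - y ^ m‖ * ‖y‖ := by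
          rw [h]
          exact (norm_add_le _ _).trans (add_le_add (norm_mul_le _ _) (norm_mul_le _ _))
      _ ≤ c ^ (m + 1) * ‖x - y‖ + (m * c ^ m * ‖x - y‖) * c := by gcongr
      _ = ((m + 1 : ℕ) : ℝ) * c ^ (m + 1) * ‖x - y‖ := by push_cast; ring

/-- The difference exp(sa)exp(sb) - exp(s(a+b)) has zero derivative at s = 0, so m times its value
at s = 1/m tends to 0. Passing to m-th powers costs only the factor m c^m, and c^m = exp(‖a‖ + ‖b‖)
does not depend on m. -/
lemma tendsto_lieTrotter (a b : 𝔸) :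
    Tendsto (fun m : ℕ => (exp ((m : ℝ)⁻¹ • a) * exp ((m : ℝ)⁻¹ • b)) ^ m) atTop
      (𝓝 (exp (a + b))) := by
  set C : ℝ := Real.exp (‖a‖ + ‖b‖)
  have hd : HasDerivAt (fun s : ℝ => exp (s • a) * exp (s • b) - exp (s • (a + b))) 0 0 := by
    have := ((hasDerivAt_exp_smul_const (𝕂 := ℝ) a 0).mul
      (hasDerivAt_exp_smul_const (𝕂 := ℝ) b 0)).sub (hasDerivAt_exp_smul_const (𝕂 := ℝ) (a + b) 0)
    exact this.congr_deriv (by simp)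
  have hs := hasDerivAt_iff_tendsto_slope_zero.1 hd
  have hm : Tendsto (fun m : ℕ => (m : ℝ)⁻¹) atTop (𝓝[≠] 0) := by
    refine tendsto_nhdsWithin_iff.2 ⟨tendsto_inv_atTop_nhds_zero_nat, ?_⟩
    filter_upwards [eventually_gt_atTop 0] with m hm
    exact inv_ne_zero (by exact_mod_cast hm.ne')
  have hlim := ((hs.comp hm).norm).const_mul C
  simp only [norm_zero, mul_zero] at hlim
  rw [tendsto_iff_norm_sub_tendsto_zero]
  refine squeeze_zero' (Eventually.of_forall fun _ => norm_nonneg _) ?_ hlim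
  filter_upwards [eventually_gt_atTop 0] with m hm
  have hm0 : (m : ℝ) ≠ 0 := by exact_mod_cast hm.ne'
  have hpow : exp (a + b) = exp ((m : ℝ)⁻¹ • (a + b)) ^ m := by
    let : NormedAlgebra ℚ 𝔸 := NormedAlgebra.restrictScalars ℚ ℝ 𝔸
    rw [← exp_nsmul, ← Nat.cast_smul_eq_nsmul ℝ, smul_smul, mul_inv_cancel₀ hm0, one_smul]
  set c : ℝ := Real.exp ((m : ℝ)⁻¹ * (‖a‖ + ‖b‖)) with hc
  have hcm : c ^ m = C := by
    rw [hc, ← Real.exp_nat_mul, ← mul_assoc, mul_inv_cancel₀ hm0, one_mul]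
  have hc1 : 1 ≤ c := Real.one_le_exp (by positivity)
  have hnorm : ∀ x : 𝔸, ‖(m : ℝ)⁻¹ • x‖ = (m : ℝ)⁻¹ * ‖x‖ := fun x => by
    rw [norm_smul, norm_inv, Real.norm_natCast]
  have hx : ‖exp ((m : ℝ)⁻¹ • a) * exp ((m : ℝ)⁻¹ • b)‖ ≤ c := by
    refine (norm_mul_le _ _).trans ?_
    rw [hc, mul_add, Real.exp_add, ← hnorm, ← hnorm]
    gcongr <;> exact norm_exp_le_exp_norm _
  have hy : ‖exp ((m : ℝ)⁻¹ • (a + b))‖ ≤ c := by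
    refine (norm_exp_le_exp_norm _).trans ?_
    rw [hnorm, hc]
    gcongr
    exact norm_add_le a b
  rw [hpow]
  refine (norm_pow_sub_pow_le hc1 hx hy m).trans (le_of_eq ?_)
  simp only [Function.comp, zero_add, zero_smul, exp_zero, mul_one, sub_self, sub_zero, inv_inv,
    norm_smul, Real.norm_natCast]
  rw [hcm]
  ring

end LieTrotter

/-! ### The Golden–Thompson inequality -/

section GoldenThompson

open Matrix Filter

variable {ι : Type*} [Fintype ι] [DecidableEq ι]

omit [DecidableEq ι] in
lemma trace_mul_transpose_nonneg (M : Matrix ι ι ℝ) : 0 ≤ (M * Mᵀ).trace := by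
  simp only [trace, diag, mul_apply, transpose_apply]
  exact Finset.sum_nonneg fun i _ => Finset.sum_nonneg fun j _ => mul_self_nonneg _

omit [DecidableEq ι] in
lemma two_mul_trace_mul_transpose_le (M N : Matrix ι ι ℝ) :
    2 * (M * Nᵀ).trace ≤ (M * Mᵀ).trace + (N * Nᵀ).trace := by
  have h := trace_mul_transpose_nonneg (M - N)
  have h2 : (N * Mᵀ).trace = (M * Nᵀ).trace := by
    rw [← trace_transpose, transpose_mul, transpose_transpose]
  rw [transpose_sub, sub_mul, mul_sub, mul_sub, trace_sub, trace_sub, trace_sub, h2] at h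
  linarith

lemma trace_mul_pow_comm (M N : Matrix ι ι ℝ) (k : ℕ) :
    ((M * N) ^ k).trace = ((N * M) ^ k).trace := by
  cases k with
  | zero => simp
  | succ k => rw [pow_succ, ← mul_assoc, mul_pow_mul, trace_mul_comm, ← mul_assoc, ← pow_succ']

/-- The two claims feed each other. For the first, apply the second to PR, rearrange cyclically, and
apply the first to P² and R². For the second, apply it to M², rearrange cyclically into (MᵀM)(MMᵀ),
apply the first, and finish with 2 tr(XYᵀ) ≤ tr(XXᵀ) + tr(YYᵀ), as MᵀM and MMᵀ have equal power
traces. -/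
lemma trace_pow_two_pow_le (j : ℕ) :
    (∀ P R : Matrix ι ι ℝ, P.IsSymm → R.IsSymm →
      ((P * R) ^ 2 ^ j).trace ≤ (P ^ 2 ^ j * R ^ 2 ^ j).trace) ∧
    ∀ M : Matrix ι ι ℝ, (M ^ 2 ^ (j + 1)).trace ≤ ((M * Mᵀ) ^ 2 ^ j).trace := by
  induction j with
  | zero =>
    refine ⟨fun P R _ _ => by simp, fun M => ?_⟩
    have h := two_mul_trace_mul_transpose_le M Mᵀ
    rw [transpose_transpose, trace_mul_comm Mᵀ M] at h
    rw [zero_add, pow_one, pow_zero, pow_one, sq]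
    linarith
  | succ j ih =>
    obtain ⟨hG, hW⟩ := ih
    constructor
    · intro P R hP hR
      refine (hW (P * R)).trans ?_
      rw [transpose_mul, hP.eq, hR.eq]
      have h1 : ((P * R * (R * P)) ^ 2 ^ j).trace = ((P * P * (R * R)) ^ 2 ^ j).trace := by
        rw [← mul_assoc, trace_mul_pow_comm]
        simp only [mul_assoc]
      rw [h1]
      refine (hG _ _ ?_ ?_).trans (le_of_eq ?_)
      · rw [IsSymm, transpose_mul, hP.eq]
      · rw [IsSymm, transpose_mul, hR.eq]
      · rw [← sq, ← sq, ← pow_mul, ← pow_mul, pow_succ']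
    · intro M
      have h1 : (M ^ 2 ^ (j + 1 + 1)).trace ≤ (((M * M) * (M * M)ᵀ) ^ 2 ^ j).trace := by
        refine le_trans (le_of_eq ?_) (hW (M * M))
        rw [← sq, ← pow_mul, ← pow_succ']
      have h2 : (((M * M) * (M * M)ᵀ) ^ 2 ^ j).trace = (((Mᵀ * M) * (M * Mᵀ)) ^ 2 ^ j).trace := by
        rw [transpose_mul, show M * M * (Mᵀ * Mᵀ) = (M * M * Mᵀ) * Mᵀ by simp only [mul_assoc],
          trace_mul_pow_comm]
        simp only [mul_assoc]
      have hs1 : (Mᵀ * M).IsSymm := by rw [IsSymm, transpose_mul, transpose_transpose]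
      have hs2 : (M * Mᵀ).IsSymm := by rw [IsSymm, transpose_mul, transpose_transpose]
      have h3 := hG _ _ hs1 hs2
      have h4 := two_mul_trace_mul_transpose_le ((Mᵀ * M) ^ 2 ^ j) ((M * Mᵀ) ^ 2 ^ j)
      rw [(hs1.pow _).eq, (hs2.pow _).eq, ← pow_add, ← pow_add, ← two_mul, ← pow_succ',
        trace_mul_pow_comm Mᵀ M] at h4
      linarith

open scoped Matrix.Norms.L2Operator in
/-- The Golden–Thompson inequality for real symmetric matrices. -/
theorem trace_exp_add_le {A B : Matrix ι ι ℝ} (hA : A.IsSymm) (hB : B.IsSymm) :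
    (NormedSpace.exp (A + B)).trace ≤ (NormedSpace.exp A * NormedSpace.exp B).trace := by
  -- The product formula assumes ‖1‖ = 1, which fails for matrices of size 0.
  rcases isEmpty_or_nonempty ι with h | h
  · simp [trace]
  have htr : Continuous (trace : Matrix ι ι ℝ → ℝ) := continuous_id.matrix_trace
  -- Only the subsequence m = 2^j is used, since the trace comparison is available for these powers.
  have hlim := (htr.tendsto _).comp ((tendsto_lieTrotter A B).comp
    (tendsto_pow_atTop_atTop_of_one_lt (r := 2) (by norm_num)))
  refine le_of_tendsto hlim (Eventually.of_forall fun j => ?_)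
  have hm : ((2 ^ j : ℕ) : ℝ) ≠ 0 := by positivity
  have hpow : ∀ X : Matrix ι ι ℝ,
      NormedSpace.exp (((2 ^ j : ℕ) : ℝ)⁻¹ • X) ^ 2 ^ j = NormedSpace.exp X := fun X => by
    rw [← Matrix.exp_nsmul, ← Nat.cast_smul_eq_nsmul ℝ, smul_smul, mul_inv_cancel₀ hm, one_smul]
  refine ((trace_pow_two_pow_le j).1 _ _ (hA.smul _).exp (hB.smul _).exp).trans (le_of_eq ?_)
  rw [hpow, hpow]

end GoldenThompson

/-! ### A matrix Chernoff bound, by counting sample sequences -/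

section MatrixChernoff

open Matrix

variable {ι N : Type*} [Fintype ι] [DecidableEq ι] [Fintype N]

open scoped Matrix.Norms.L2Operator in
lemma exp_smul_of_mul_self_eq {p : Matrix ι ι ℝ} (hp : p * p = p) (t : ℝ) :
    NormedSpace.exp (t • p) = 1 + (Real.exp t - 1) • p := by
  have h := NormedSpace.exp_series_hasSum_exp' (𝕂 := ℝ) (t • p)
  have h' := NormedSpace.exp_series_hasSum_exp' (𝕂 := ℝ) t
  rw [← Real.exp_eq_exp_ℝ] at h'
  have h2 := (h'.smul_const p).add (hasSum_ite_eq 0 (1 - p))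
  have hpow : ∀ n : ℕ, p ^ (n + 1) = p := fun n => IsIdempotentElem.pow_succ_eq n hp
  have hterm : (fun n : ℕ => ((n.factorial : ℝ)⁻¹) • (t • p) ^ n) =
      fun n : ℕ => (((n.factorial : ℝ)⁻¹) • t ^ n) • p + if n = 0 then 1 - p else 0 := by
    funext n
    cases n with
    | zero => simp
    | succ n => simp [smul_pow, hpow, smul_smul]
  rw [hterm] at h
  rw [h.unique h2]
  module

/-- For a ≠ 0, a aᵀ is |a|² times a projection, so its exponential is explicit. The bound by L is
then convexity of the scalar exponential: it lies below its chord between 0 and sL. The sign of s is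
irrelevant, so both tails are covered. -/
lemma dotProduct_exp_vecMulVec_mulVec_le (a x : ι → ℝ) {s L : ℝ} (hL : 0 < L) (ha : a ⬝ᵥ a ≤ L) :
    x ⬝ᵥ NormedSpace.exp (s • vecMulVec a a) *ᵥ x ≤
      x ⬝ᵥ x + (Real.exp (s * L) - 1) / L * (a ⬝ᵥ x) ^ 2 := by
  have hq0 : 0 ≤ a ⬝ᵥ a := Finset.sum_nonneg fun i _ => mul_self_nonneg _
  rcases hq0.eq_or_lt with hq | hq
  · have : a = 0 := dotProduct_self_eq_zero.1 hq.symm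
    simp [this]
  set q := a ⬝ᵥ a
  have hp : (q⁻¹ • vecMulVec a a) * (q⁻¹ • vecMulVec a a) = q⁻¹ • vecMulVec a a := by
    rw [smul_mul_smul_comm, vecMulVec_mul_vecMulVec, vecMulVec_smul, smul_smul]
    congr 1
    change q⁻¹ * q⁻¹ * q = q⁻¹
    field_simp
  have h1 : s • vecMulVec a a = (s * q) • (q⁻¹ • vecMulVec a a) := by
    rw [smul_smul, mul_assoc, mul_inv_cancel₀ hq.ne', mul_one]
  rw [h1, exp_smul_of_mul_self_eq hp, add_mulVec, one_mulVec, dotProduct_add, smul_mulVec,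
    smul_mulVec, vecMulVec_mulVec, dotProduct_smul, dotProduct_smul]
  have h2 : x ⬝ᵥ (MulOpposite.op (a ⬝ᵥ x) • a) = (a ⬝ᵥ x) ^ 2 := by
    rw [dotProduct_smul, dotProduct_comm x a, sq]; rfl
  rw [h2]
  have hconv : Real.exp (s * q) - 1 ≤ q / L * (Real.exp (s * L) - 1) := by
    have h : Real.exp ((1 - q / L) • (0 : ℝ) + (q / L) • (s * L)) ≤
        (1 - q / L) • Real.exp 0 + (q / L) • Real.exp (s * L) :=
      convexOn_exp.2 (Set.mem_univ _) (Set.mem_univ _) (sub_nonneg.2 ((div_le_one hL).2 ha)) (by positivity) (by ring)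
    simp only [smul_eq_mul, mul_zero, zero_add, Real.exp_zero, mul_one] at h
    rw [show q / L * (s * L) = s * q by field_simp] at h
    linarith
  simp only [smul_eq_mul]
  rw [← mul_assoc]
  gcongr
  calc (Real.exp (s * q) - 1) * q⁻¹ ≤ q / L * (Real.exp (s * L) - 1) * q⁻¹ := by gcongr
    _ = _ := by field_simp

lemma exp_eq_mul_transpose_half {S : Matrix ι ι ℝ} (hS : S.IsSymm) :
    NormedSpace.exp S = NormedSpace.exp ((1 / 2 : ℝ) • S) * (NormedSpace.exp ((1 / 2 : ℝ) • S))ᵀ := by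
  rw [((hS.smul (1 / 2 : ℝ)).exp).eq, ← Matrix.exp_add_of_commute _ _ (Commute.refl _), ← add_smul]
  norm_num

/-- With the symmetric square root C = exp(S/2), the trace is the sum of the values of the quadratic
form of M at the rows of C. -/
lemma trace_exp_mul_le {S M : Matrix ι ι ℝ} (hS : S.IsSymm) {c : ℝ}
    (hM : ∀ x, x ⬝ᵥ M *ᵥ x ≤ c * (x ⬝ᵥ x)) :
    (NormedSpace.exp S * M).trace ≤ c * (NormedSpace.exp S).trace := by
  have hC : (NormedSpace.exp ((1 / 2 : ℝ) • S)).IsSymm := (hS.smul _).exp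
  rw [exp_eq_mul_transpose_half hS]
  set C := NormedSpace.exp ((1 / 2 : ℝ) • S)
  rw [hC.eq, mul_assoc, trace_mul_comm, trace, trace, Finset.mul_sum]
  refine Finset.sum_le_sum fun i _ => ?_
  have h := hM (C i)
  have h1 : (C * M * C) i i = C i ⬝ᵥ M *ᵥ C i := by
    rw [mul_assoc, mul_apply']
    congr 1
    ext j
    rw [mul_apply', mulVec]
    congr 1
    ext l
    exact (congrFun (congrFun hC.eq i) l)
  have h2 : (C * C) i i = C i ⬝ᵥ C i := by
    rw [mul_apply']
    congr 1
    ext l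
    exact (congrFun (congrFun hC.eq i) l)
  rw [diag_apply, diag_apply, h1, h2]
  exact h

/-- The Ahlswede–Winter induction: split off one sample by Golden–Thompson, sum over its values
first, and replace the resulting matrix by c times the identity. -/
lemma sum_trace_exp_sum_le {X : N → Matrix ι ι ℝ} (hX : ∀ w, (X w).IsSymm) {c : ℝ} (hc : 0 ≤ c)
    (hM : ∀ x, x ⬝ᵥ (∑ w, NormedSpace.exp (X w)) *ᵥ x ≤ c * (x ⬝ᵥ x)) (K : ℕ) :
    ∑ w : Fin K → N, (NormedSpace.exp (∑ j, X (w j))).trace ≤ c ^ K * Fintype.card ι := by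
  induction K with
  | zero => simp
  | succ K ih =>
    have hS : ∀ w : Fin K → N, (∑ j, X (w j)).IsSymm := fun w => by
      rw [IsSymm, transpose_sum]
      exact Finset.sum_congr rfl fun j _ => hX _
    rw [← (Fin.consEquiv (fun _ => N)).sum_comp, Fintype.sum_prod_type_right, pow_succ, mul_right_comm]
    refine le_trans ?_ (mul_le_mul_of_nonneg_right ih hc)
    rw [Finset.sum_mul]
    refine Finset.sum_le_sum fun w _ => ?_
    rw [mul_comm _ c]
    refine le_trans ?_ (trace_exp_mul_le (hS w) hM)
    rw [Finset.mul_sum, trace_sum]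
    refine Finset.sum_le_sum fun v _ => ?_
    refine le_trans (le_of_eq ?_) (trace_exp_add_le (hS w) (hX v))
    rw [Fin.sum_univ_succ, add_comm]
    simp [Fin.consEquiv]

lemma trace_exp_smul_eq_sum {M : Matrix ι ι ℝ} (hM : M.IsHermitian) (s : ℝ) :
    (NormedSpace.exp (s • M)).trace = ∑ i, Real.exp (s * hM.eigenvalues i) := by
  set U : Matrix ι ι ℝ := (hM.eigenvectorUnitary : Matrix ι ι ℝ)
  have hU : IsUnit U := (Unitary.toUnits hM.eigenvectorUnitary).isUnit
  have hUinv : U⁻¹ = star U := by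
    refine inv_eq_right_inv ?_
    exact Unitary.coe_mul_star_self hM.eigenvectorUnitary
  have h : s • M = U * diagonal (fun i => s * hM.eigenvalues i) * U⁻¹ := by
    conv_lhs => rw [hM.spectral_theorem]
    rw [hUinv, Unitary.conjStarAlgAut_apply, ← smul_mul_assoc, ← mul_smul_comm, ← diagonal_smul]
    rfl
  rw [h, Matrix.exp_conj _ _ hU, Matrix.exp_diagonal, trace_mul_comm, ← mul_assoc,
    nonsing_inv_mul _ ((isUnit_iff_isUnit_det _).1 hU), one_mul, trace_diagonal]
  refine Finset.sum_congr rfl fun i _ => ?_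
  rw [Pi.coe_exp, Real.exp_eq_exp_ℝ]

omit [Fintype ι] [DecidableEq ι] [Fintype N] in
lemma isHermitian_sum_vecMulVec (a : N → ι → ℝ) {K : ℕ} (w : Fin K → N) :
    (∑ j, vecMulVec (a (w j)) (a (w j))).IsHermitian := by
  rw [IsHermitian, conjTranspose_sum]
  refine Finset.sum_congr rfl fun j _ => ?_
  ext i k
  simp [vecMulVec_apply, mul_comm]

lemma sum_trace_exp_smul_sum_vecMulVec_le [Nonempty N] (a : N → ι → ℝ) {L : ℝ} (hL : 0 < L)
    (ha : ∀ w, a w ⬝ᵥ a w ≤ L) (hsum : ∑ w, vecMulVec (a w) (a w) = 1) (s : ℝ) (K : ℕ) :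
    ∑ w : Fin K → N, (NormedSpace.exp (s • ∑ j, vecMulVec (a (w j)) (a (w j)))).trace ≤
      Fintype.card ι * (Fintype.card N : ℝ) ^ K *
        Real.exp (K / Fintype.card N * ((Real.exp (s * L) - 1) / L)) := by
  set ν : ℝ := (Fintype.card N : ℝ) with hν
  have hν0 : 0 < ν := Nat.cast_pos.2 Fintype.card_pos
  set g : ℝ := (Real.exp (s * L) - 1) / L with hg
  have h := sum_trace_exp_sum_le (X := fun w => s • vecMulVec (a w) (a w)) (c := ν * Real.exp (g / ν))
    -- The constant c = ν exp(g/ν) arises because the matrices exp(s a aᵀ) sum to at most (ν + g)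
    -- times the identity, and 1 + g/ν ≤ exp(g/ν).
    (fun w => by
      rw [IsSymm, transpose_smul]
      congr 1
      ext i k
      simp [vecMulVec_apply, mul_comm]) (by positivity) (fun x => ?_) K
  · simp_rw [Finset.smul_sum]
    refine h.trans (le_of_eq ?_)
    rw [mul_pow, ← Real.exp_nat_mul]
    ring_nf
  · rw [Matrix.sum_mulVec, dotProduct_sum]
    have h1 : ∑ w, (a w ⬝ᵥ x) ^ 2 = x ⬝ᵥ x := by
      have : x ⬝ᵥ (∑ w, vecMulVec (a w) (a w)) *ᵥ x = x ⬝ᵥ x := by rw [hsum, one_mulVec]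
      rw [← this, Matrix.sum_mulVec, dotProduct_sum]
      refine Finset.sum_congr rfl fun w _ => ?_
      rw [vecMulVec_mulVec, dotProduct_smul, dotProduct_comm x, sq]; rfl
    have hx : 0 ≤ x ⬝ᵥ x := Finset.sum_nonneg fun i _ => mul_self_nonneg _
    calc _ ≤ ∑ w, (x ⬝ᵥ x + g * (a w ⬝ᵥ x) ^ 2) :=
          Finset.sum_le_sum fun w _ => dotProduct_exp_vecMulVec_mulVec_le _ _ hL (ha w)
      _ = ν * (g / ν + 1) * (x ⬝ᵥ x) := by
          rw [Finset.sum_add_distrib, ← Finset.mul_sum, h1, Finset.sum_const, Finset.card_univ,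
            nsmul_eq_mul, ← hν]
          field_simp
          ring
      _ ≤ _ := by
          gcongr
          exact Real.add_one_le_exp _

/-- The exponent log(1 + ε) minimizes the left side. Two terms of the series of log(1 + ε) in powers
of ε/(ε + 2) are enough for the constant 3/8 on all of (0, 1); this is the origin of the 8/3 in the
theorem. -/
lemma upper_rate_le {ε : ℝ} (h0 : 0 < ε) (h1 : ε < 1) :
    (Real.exp (Real.log (1 + ε)) - 1) - Real.log (1 + ε) * (1 + ε) ≤ -(3 / 8 * ε ^ 2) := by
  rw [Real.exp_log (by linarith)]
  have h := (Real.hasSum_log_one_add h0.le).summable.sum_le_tsum (Finset.range 2)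
    (fun i _ => by positivity)
  rw [(Real.hasSum_log_one_add h0.le).tsum_eq] at h
  simp only [Finset.sum_range_succ, Finset.range_zero, Finset.sum_empty] at h
  norm_num at h
  have key : ε + 3 / 8 * ε ^ 2 ≤
      (2 * (ε / (ε + 2)) + 2 / 3 * (ε / (ε + 2)) ^ 3) * (1 + ε) := by
    have : 0 < ε + 2 := by linarith
    rw [div_pow, ← sub_nonneg]
    have e : (2 * (ε / (ε + 2)) + 2 / 3 * (ε ^ 3 / (ε + 2) ^ 3)) * (1 + ε) - (ε + 3 / 8 * ε ^ 2)
      = ε ^ 2 * ((ε + 2) ^ 2 + 2 / 3 * ε * (1 + ε) - 3 / 8 * (ε + 2) ^ 3) / (ε + 2) ^ 3 := by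
      field_simp
      ring
    rw [e]
    have : 0 ≤ (ε + 2) ^ 2 + 2 / 3 * ε * (1 + ε) - 3 / 8 * (ε + 2) ^ 3 := by
      nlinarith [mul_pos h0 h0, mul_pos h0 (sub_pos.2 h1), mul_pos (mul_pos h0 h0) (sub_pos.2 h1)]
    positivity
  nlinarith

/-- The exponent -ε is simpler than the optimal log(1 - ε) and already yields the rate ε²/2. -/
lemma lower_rate_le {ε : ℝ} (h0 : 0 < ε) (h1 : ε < 1) :
    (Real.exp (-ε) - 1) - (-ε) * (1 - ε) ≤ -(3 / 8 * ε ^ 2) := by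
  have h : Real.exp (-ε) ≤ 1 - ε + ε ^ 2 / 2 := by
    have h2 := Real.quadratic_le_exp_of_nonneg h0.le
    rw [Real.exp_neg]
    refine inv_le_of_inv_le₀ (by nlinarith) (le_trans ?_ h2)
    rw [inv_le_iff_one_le_mul₀ (by nlinarith)]
    nlinarith [pow_pos h0 4]
  nlinarith

-- Markov's inequality for the trace exponential: one eigenvalue satisfying p forces the trace to be
-- at least exp((σ/L)ρδ), where ρ = K/|N|. Taking σ > 0 gives the upper tail and σ < 0 the lower
-- one.
open Classical in
lemma exists_card_le_forall_not_eigenvalues [Nonempty N] (a : N → ι → ℝ) {L : ℝ} (hL : 0 < L)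
    (ha : ∀ w, a w ⬝ᵥ a w ≤ L) (hsum : ∑ w, vecMulVec (a w) (a w) = 1) (K : ℕ) (σ δ ε : ℝ)
    (p : ℝ → Prop) (hp : ∀ x, p x → σ / L * (K / Fintype.card N * δ) ≤ σ / L * x)
    (hσ : (Real.exp σ - 1) - σ * δ ≤ -(3 / 8 * ε ^ 2)) :
    ∃ F : Finset (Fin K → N), (F.card : ℝ) ≤ Fintype.card ι * (Fintype.card N : ℝ) ^ K *
        Real.exp (-(3 / 8 * ε ^ 2 * (K / Fintype.card N / L))) ∧
      ∀ w ∉ F, ∀ i, ¬ p ((isHermitian_sum_vecMulVec a w).eigenvalues i) := by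
  have h := sum_trace_exp_smul_sum_vecMulVec_le a hL ha hsum (σ / L) K
  rw [div_mul_cancel₀ _ hL.ne'] at h
  set ρ : ℝ := K / Fintype.card N with hρ
  have hρ0 : 0 ≤ ρ := by positivity
  set F := Finset.univ.filter fun w : Fin K → N =>
      ∃ i, p ((isHermitian_sum_vecMulVec a w).eigenvalues i)
  have h1 : (F.card : ℝ) * Real.exp (σ / L * (ρ * δ)) ≤
      ∑ w : Fin K → N, (NormedSpace.exp ((σ / L) • ∑ j, vecMulVec (a (w j)) (a (w j)))).trace := by
    rw [← nsmul_eq_mul, ← Finset.sum_const]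
    refine (Finset.sum_le_sum fun w hw => ?_).trans
      (Finset.sum_le_sum_of_subset_of_nonneg (Finset.subset_univ F) fun w _ _ => ?_)
    · obtain ⟨i, hi⟩ := (Finset.mem_filter.1 hw).2
      rw [trace_exp_smul_eq_sum (isHermitian_sum_vecMulVec a w)]
      refine (Real.exp_le_exp.2 (hp _ hi)).trans ?_
      exact Finset.single_le_sum
        (f := fun i => Real.exp (σ / L * (isHermitian_sum_vecMulVec a w).eigenvalues i))
        (fun i _ => (Real.exp_pos _).le) (Finset.mem_univ i)
    · rw [trace_exp_smul_eq_sum (isHermitian_sum_vecMulVec a w)]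
      exact Finset.sum_nonneg fun i _ => (Real.exp_pos _).le
  have h2 := h1.trans h
  rw [← le_div_iff₀ (Real.exp_pos _), mul_div_assoc, ← Real.exp_sub] at h2
  refine ⟨F, h2.trans ?_, fun w hw i hi => hw (Finset.mem_filter.2 ⟨Finset.mem_univ _, i, hi⟩)⟩
  gcongr
  have e : ρ * ((Real.exp σ - 1) / L) - σ / L * (ρ * δ) = ρ / L * ((Real.exp σ - 1) - σ * δ) := by
    field_simp
  rw [e]
  calc _ ≤ ρ / L * (-(3 / 8 * ε ^ 2)) := by gcongr
    _ = _ := by ring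

open Classical in
/-- A matrix Chernoff bound for sums of independent uniformly chosen rank-one matrices. -/
theorem exists_card_le_forall_eigenvalues_lt [Nonempty N] (a : N → ι → ℝ) {L : ℝ} (hL : 0 < L)
    (ha : ∀ w, a w ⬝ᵥ a w ≤ L) (hsum : ∑ w, vecMulVec (a w) (a w) = 1) (K : ℕ) {ε : ℝ}
    (h0 : 0 < ε) (h1 : ε < 1) :
    ∃ F : Finset (Fin K → N), (F.card : ℝ) ≤ 2 * (Fintype.card ι * (Fintype.card N : ℝ) ^ K *
        Real.exp (-(3 / 8 * ε ^ 2 * (K / Fintype.card N / L)))) ∧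
      ∀ w ∉ F, ∀ i, |(isHermitian_sum_vecMulVec a w).eigenvalues i -
        K / Fintype.card N| < ε * (K / Fintype.card N) := by
  have hlog : 0 ≤ Real.log (1 + ε) := Real.log_nonneg (by linarith)
  obtain ⟨F, hF, hu⟩ := exists_card_le_forall_not_eigenvalues a hL ha hsum K (Real.log (1 + ε)) (1 + ε) ε
    (fun x => K / Fintype.card N * (1 + ε) ≤ x) (fun x hx => by gcongr) (upper_rate_le h0 h1)
  obtain ⟨G, hG, hl⟩ := exists_card_le_forall_not_eigenvalues a hL ha hsum K (-ε) (1 - ε) ε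
    (fun x => x ≤ K / Fintype.card N * (1 - ε))
    (fun x hx => mul_le_mul_of_nonpos_left hx (div_nonpos_of_nonpos_of_nonneg (by linarith) hL.le))
    (lower_rate_le h0 h1)
  refine ⟨F ∪ G, ?_, fun w hw i => ?_⟩
  · rw [two_mul]
    refine le_trans ?_ (add_le_add hF hG)
    exact_mod_cast Finset.card_union_le _ _
  · rw [Finset.mem_union, not_or] at hw
    rw [abs_lt]
    constructor <;> linarith [not_le.1 (hu w hw.1 i), not_le.1 (hl w hw.2 i)]

end MatrixChernoff

/-! ### From counting sequences to probabilities -/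

section UniformSample

variable {N : Type*} [Fintype N] [MeasurableSpace N] [MeasurableSingletonClass N]

lemma measureReal_uniform_sample_mem {S : Type*} [MeasurableSpace S] (P : Measure S)
    [IsProbabilityMeasure P] {K : ℕ} {w : Fin K → S → N} (hmeas : ∀ j, Measurable (w j))
    (hindep : iIndepFun w P) (hunif : ∀ j, P.map (w j) = uniformOn Set.univ)
    (F : Finset (Fin K → N)) :
    P.real {s | (fun j => w j s) ∈ F} = F.card / (Fintype.card N : ℝ) ^ K := by
  have hmap := (iIndepFun_iff_map_fun_eq_pi_map (fun j => (hmeas j).aemeasurable)).1 hindep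
  have hW : Measurable fun s j => w j s := measurable_pi_lambda _ hmeas
  have hsing : ∀ v : Fin K → N, (Measure.pi fun j => P.map (w j)) {v} =
      ((Fintype.card N : ENNReal)⁻¹) ^ K := fun v => by
    have : ∀ j, IsProbabilityMeasure (P.map (w j)) := fun j =>
      Measure.isProbabilityMeasure_map (hmeas j).aemeasurable
    rw [← Set.univ_pi_singleton, Measure.pi_pi]
    simp_rw [hunif, uniformOn_univ, Measure.count_singleton]
    simp
  have h1 : P {s | (fun j => w j s) ∈ F} = F.card * ((Fintype.card N : ENNReal)⁻¹) ^ K := by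
    change P ((fun s j => w j s) ⁻¹' (F : Set (Fin K → N))) = _
    rw [← Measure.map_apply hW F.measurableSet, hmap, ← sum_measure_singleton]
    simp_rw [hsing]
    simp
  rw [Measure.real, h1]
  simp [div_eq_mul_inv]

end UniformSample

/-! ### Restricted isometry on a subspace with small entries -/

section Restricted

open Matrix

lemma norm_sub_smul_toEuclideanLin_le {ι : Type*} [Fintype ι] [DecidableEq ι]
    {M : Matrix ι ι ℝ} (hM : M.IsHermitian) {ρ δ : ℝ} (hδ : 0 ≤ δ)
    (h : ∀ i, |1 - ρ⁻¹ * hM.eigenvalues i| ≤ δ) (c : EuclideanSpace ℝ ι) :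
    ‖c - ρ⁻¹ • toEuclideanLin M c‖ ≤ δ * ‖c‖ := by
  have hsym := isSymmetric_toEuclideanLin_iff.2 hM
  have hcoef : ∀ i, inner ℝ (hM.eigenvectorBasis i) (c - ρ⁻¹ • toEuclideanLin M c) =
      (1 - ρ⁻¹ * hM.eigenvalues i) * inner ℝ (hM.eigenvectorBasis i) c := fun i => by
    have he : toEuclideanLin M (hM.eigenvectorBasis i) =
        hM.eigenvalues i • hM.eigenvectorBasis i := by
      rw [toLpLin_apply, hM.mulVec_eigenvectorBasis]
      rfl
    rw [inner_sub_right, inner_smul_right, ← hsym, he, inner_smul_left]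
    simp only [conj_trivial]
    ring
  refine abs_le_of_sq_le_sq' ?_ (by positivity) |>.2
  rw [← hM.eigenvectorBasis.sum_sq_norm_inner_right, mul_pow,
    ← hM.eigenvectorBasis.sum_sq_norm_inner_right c, Finset.mul_sum]
  refine Finset.sum_le_sum fun i _ => ?_
  rw [hcoef, norm_mul, mul_pow, Real.norm_eq_abs]
  gcongr
  exact h i

variable {d : ℕ} {n : Fin d → ℕ}

/-- The coordinates of the projection of `E_e` onto `T` in an orthonormal basis of `T`. -/
noncomputable def sampleVector (T : Submodule ℝ (Tensor n)) (e : Index n) :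
    Fin (Module.finrank ℝ T) → ℝ := fun i => (stdOrthonormalBasis ℝ T i : Tensor n) e

lemma numEntries_eq_card : numEntries n = Fintype.card (Index n) := by
  simp [numEntries, Fintype.card_pi]

lemma sum_vecMulVec_sampleVector (T : Submodule ℝ (Tensor n)) :
    ∑ e, vecMulVec (sampleVector T e) (sampleVector T e) = 1 := by
  ext i j
  have h := orthonormal_iff_ite.1 (stdOrthonormalBasis ℝ T).orthonormal i j
  rw [Submodule.coe_inner, PiLp.inner_apply] at h
  rw [Matrix.sum_apply, Matrix.one_apply]
  simpa [vecMulVec_apply, sampleVector, mul_comm] using h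

/-- The projection y of E_e onto T satisfies y(e) = ‖y‖² = |a|², so the entry bound applied to y
itself reads |a|⁴ ≤ L|a|². -/
lemma sampleVector_dotProduct_self_le {T : Submodule ℝ (Tensor n)} {L : ℝ} (hL : 0 ≤ L)
    (hT : ∀ x ∈ T, ∀ e, x e ^ 2 ≤ L * ‖x‖ ^ 2) (e : Index n) :
    sampleVector T e ⬝ᵥ sampleVector T e ≤ L := by
  set b := stdOrthonormalBasis ℝ T
  set y : T := ∑ i, sampleVector T e i • b i
  set q := sampleVector T e ⬝ᵥ sampleVector T e with hq
  have hq0 : 0 ≤ q := Finset.sum_nonneg fun i _ => mul_self_nonneg _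
  have h1 : (y : Tensor n) e = q := by
    simp [y, hq, dotProduct, sampleVector, b]
  have h2 : ‖(y : Tensor n)‖ ^ 2 = q := by
    rw [← Submodule.coe_norm, ← b.sum_sq_norm_inner_right]
    simp only [y, b.orthonormal.inner_right_fintype, hq, dotProduct, Real.norm_eq_abs, sq, abs_mul_abs_self]
  have h := hT y y.2 e
  rw [h1, h2] at h
  rcases hq0.eq_or_lt with h0 | h0
  · rwa [← h0]
  · nlinarith

lemma ripOn_of_eigenvalues (hn : ∀ k, 0 < n k) {K : ℕ} (hK : 0 < K) (w : Fin K → Index n)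
    (T : Submodule ℝ (Tensor n)) {ε : ℝ} (hε : 0 < ε)
    (h : ∀ i, |(isHermitian_sum_vecMulVec (sampleVector T) w).eigenvalues i -
      K / Fintype.card (Index n)| < ε * (K / Fintype.card (Index n))) :
    RIPOn w T ε := by
  have : ∀ k, Nonempty (Fin (n k)) := fun k => ⟨⟨0, hn k⟩⟩
  set b := stdOrthonormalBasis ℝ T with hb
  set M := ∑ j, vecMulVec (sampleVector T (w j)) (sampleVector T (w j)) with hM
  have hMh : M.IsHermitian := isHermitian_sum_vecMulVec (sampleVector T) w
  set ρ : ℝ := density n K with hρ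
  have hρ' : (K : ℝ) / Fintype.card (Index n) = ρ := by rw [hρ, density, numEntries_eq_card]
  have hρ0 : 0 < ρ := by
    rw [← hρ']
    have : 0 < Fintype.card (Index n) := Fintype.card_pos
    positivity
  rw [hρ'] at h
  -- A maximum over finitely many eigenvalues keeps the final inequality strict; for T = 0 it is 0.
  set δ : NNReal := Finset.univ.sup fun i => ‖1 - ρ⁻¹ * hMh.eigenvalues i‖₊ with hδ
  have hδε : (δ : ℝ) < ε := by
    have : δ < (⟨ε, hε.le⟩ : NNReal) := by
      refine (Finset.sup_lt_iff (show (0 : NNReal) < ⟨ε, hε.le⟩ from hε)).2 ?_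
      intro i _
      change ‖1 - ρ⁻¹ * hMh.eigenvalues i‖ < ε
      have e1 : 1 - ρ⁻¹ * hMh.eigenvalues i = -(ρ⁻¹ * (hMh.eigenvalues i - ρ)) := by
        field_simp
        ring
      rw [e1, norm_neg, norm_mul, Real.norm_eq_abs, Real.norm_eq_abs, abs_of_pos (inv_pos.2 hρ0),
        inv_mul_lt_iff₀ hρ0, mul_comm]
      exact h i
    exact this
  refine lt_of_le_of_lt (ContinuousLinearMap.opNorm_le_bound _ δ.2 fun x => ?_) hδε
  set c : EuclideanSpace ℝ (Fin (Module.finrank ℝ T)) := b.repr (T.orthogonalProjectionOnto x) with hc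
  have hPx : ∀ z, T.starProjection z = (b.repr.symm (b.repr (T.orthogonalProjectionOnto z)) : T) := by
    intro z
    rw [LinearIsometryEquiv.symm_apply_apply]
    rfl
  have hcoord : ∀ e, (T.starProjection x) e = ∑ l, c l * sampleVector T e l := fun e => by
    rw [hPx, ← hc, ← b.sum_repr_symm]
    simp [sampleVector, hb]
  have hR : b.repr (T.orthogonalProjectionOnto (samplingOp w (T.starProjection x))) =
      toEuclideanLin M c := by
    ext i
    rw [OrthonormalBasis.repr_apply_apply, Submodule.inner_orthogonalProjectionOnto_eq_of_mem_left,
      toLpLin_apply, hM, Matrix.sum_mulVec]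
    have hproj : ∀ j, (EuclideanSpace.proj (w j) : Tensor n →L[ℝ] ℝ) (T.starProjection x) =
        ∑ l, c l * sampleVector T (w j) l := fun j => hcoord (w j)
    simp only [samplingOp, _root_.sum_apply, inner_sum, ContinuousLinearMap.smulRight_apply,
      inner_smul_right, hproj]
    change _ = (∑ j, vecMulVec (sampleVector T (w j)) (sampleVector T (w j)) *ᵥ c) i
    rw [Finset.sum_apply]
    refine Finset.sum_congr rfl fun j _ => ?_
    have hin : inner ℝ (b i : Tensor n) (EuclideanSpace.single (w j) 1) =
        sampleVector T (w j) i := by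
      rw [EuclideanSpace.inner_single_right, one_mul]
      rfl
    rw [hin, vecMulVec_mulVec, Pi.smul_apply, op_smul_eq_smul, smul_eq_mul,
      dotProduct_comm]
    rfl
  have hfin : (T.starProjection - ρ⁻¹ •
      (T.starProjection ∘L samplingOp w ∘L T.starProjection)) x =
      (b.repr.symm (c - ρ⁻¹ • toEuclideanLin M c) : T) := by
    rw [map_sub, map_smul, ← hR, hc, LinearIsometryEquiv.symm_apply_apply,
      LinearIsometryEquiv.symm_apply_apply]
    rfl
  rw [hfin, ← Submodule.coe_norm, LinearIsometryEquiv.norm_map]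
  refine (norm_sub_smul_toEuclideanLin_le hMh δ.2 (fun i => ?_) c).trans ?_
  · exact_mod_cast Finset.le_sup (f := fun i => ‖1 - ρ⁻¹ * hMh.eigenvalues i‖₊) (Finset.mem_univ i)
  · rw [hc, LinearIsometryEquiv.norm_map]
    refine mul_le_mul_of_nonneg_left ?_ δ.2
    exact T.norm_orthogonalProjectionOnto_apply_le x

/-- Restricted isometry on a subspace whose elements have small entries, for uniform sampling with
replacement. -/
theorem one_sub_le_measureReal_ripOn (hn : ∀ k, 0 < n k) (T : Submodule ℝ (Tensor n)) {L : ℝ}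
    (hL : 0 < L) (hT : ∀ x ∈ T, ∀ e, x e ^ 2 ≤ L * ‖x‖ ^ 2)
    {S : Type*} [MeasurableSpace S] (P : Measure S) [IsProbabilityMeasure P]
    {K : ℕ} (hK : 0 < K) (w : Fin K → S → Index n) (hmeas : ∀ j, Measurable (w j))
    (hindep : iIndepFun w P) (hunif : ∀ j, P.map (w j) = uniformOn Set.univ)
    {ε : ℝ} (hε0 : 0 < ε) (hε1 : ε < 1) :
    1 - 2 * (numEntries n * Real.exp (-(3 / 8 * ε ^ 2 * (density n K / L)))) ≤
      P.real {s | RIPOn (fun j => w j s) T ε} := by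
  have : ∀ k, Nonempty (Fin (n k)) := fun k => ⟨⟨0, hn k⟩⟩
  obtain ⟨F, hcount, hgood⟩ := exists_card_le_forall_eigenvalues_lt (sampleVector T) hL
    (sampleVector_dotProduct_self_le hL.le hT) (sum_vecMulVec_sampleVector T) K hε0 hε1
  have hν : 0 < (Fintype.card (Index n) : ℝ) := Nat.cast_pos.2 Fintype.card_pos
  have hF := measureReal_uniform_sample_mem P hmeas hindep hunif F
  have hcover : (Set.univ : Set S) ⊆ {s | RIPOn (fun j => w j s) T ε} ∪
      {s | (fun j => w j s) ∈ F} := fun s _ => by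
    by_cases hs : (fun j => w j s) ∈ F
    · exact Or.inr hs
    · exact Or.inl (ripOn_of_eigenvalues hn hK _ T hε0 (hgood _ hs))
  have h1 : (1 : ℝ) ≤ P.real {s | RIPOn (fun j => w j s) T ε} +
      P.real {s | (fun j => w j s) ∈ F} := by
    rw [← probReal_univ (μ := P)]
    exact (measureReal_mono hcover).trans (measureReal_union_le _ _)
  have hdim : (Module.finrank ℝ T : ℝ) ≤ Fintype.card (Index n) := by
    have := T.finrank_le
    rw [finrank_euclideanSpace] at this
    exact_mod_cast this
  have h2 : P.real {s | (fun j => w j s) ∈ F} ≤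
      2 * (numEntries n * Real.exp (-(3 / 8 * ε ^ 2 * (density n K / L)))) := by
    rw [hF, div_le_iff₀ (by positivity), density, numEntries_eq_card]
    refine hcount.trans ?_
    rw [Fintype.card_fin]
    calc _ ≤ 2 * ((Fintype.card (Index n) : ℝ) * (Fintype.card (Index n) : ℝ) ^ K *
        Real.exp (-(3 / 8 * ε ^ 2 * (K / Fintype.card (Index n) / L)))) := by gcongr
      _ = _ := by ring
  linarith

end Restricted

/-! ### Fibres, interface spaces and projections of unfoldings -/

section Columns

variable {d : ℕ} {n : Fin d → ℕ}

/-- The multi-index that agrees with `i` where `p` holds and with `j` elsewhere. -/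
def merge (p : Fin d → Prop) [DecidablePred p] (i j : Index n) : Index n :=
  fun l => if p l then i l else j l

variable (p q : Fin d → Prop) [DecidablePred p] [DecidablePred q]

@[simp] lemma merge_self (i : Index n) : merge p i i = i := by
  funext l; simp [merge]

@[simp] lemma merge_merge_left (i j k : Index n) : merge p (merge p i j) k = merge p i k := by
  funext l; by_cases h : p l <;> simp [merge, h]

@[simp] lemma merge_merge_right (i j k : Index n) : merge p i (merge p j k) = merge p i k := by
  funext l; by_cases h : p l <;> simp [merge, h]

lemma merge_not (i j : Index n) : merge (fun l => ¬ p l) i j = merge p j i := by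
  funext l; by_cases h : p l <;> simp [merge, h]

lemma merge_apply_of {p : Fin d → Prop} [DecidablePred p] (i j : Index n) {l : Fin d} (h : p l) :
    merge p i j l = i l := if_pos h

lemma merge_apply_of_not {p : Fin d → Prop} [DecidablePred p] (i j : Index n) {l : Fin d}
    (h : ¬ p l) : merge p i j l = j l := if_neg h

/-- Averaging over a pair of multi-indices is averaging over the merged multi-index. -/
lemma sum_sum_merge (F : Index n → Index n → ℝ) :
    ∑ b, ∑ i, F (merge p i b) (merge p b i) = ∑ b, ∑ i, F i b := by
  rw [← Fintype.sum_prod_type', ← Fintype.sum_prod_type' (f := fun b i => F i b)]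
  -- Exchanging the complementary parts of two multi-indices is an involution on pairs.
  refine Finset.sum_bij' (fun x _ => (merge p x.1 x.2, merge p x.2 x.1))
    (fun x _ => (merge p x.1 x.2, merge p x.2 x.1)) ?_ ?_ ?_ ?_ ?_ <;> simp

lemma sum_sum_merge' (F : Index n → ℝ) :
    ∑ b, ∑ i, F (merge p i b) = Fintype.card (Index n) * ∑ i, F i := by
  rw [sum_sum_merge p fun i _ => F i]
  simp

/-- The fibre of `X` through `b` in the directions selected by `p`, as a tensor that does not depend
on the other indices. -/
noncomputable def column : Tensor n →ₗ[ℝ] Index n → Tensor n where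
  toFun X b := WithLp.toLp 2 fun i => X (merge p i b)
  map_add' _ _ := rfl
  map_smul' _ _ := rfl

@[simp] lemma column_apply (X : Tensor n) (b i : Index n) : column p X b i = X (merge p i b) := rfl

/-- The span of the fibres of `X` in the directions selected by `p`. -/
noncomputable def columnSpace (X : Tensor n) : Submodule ℝ (Tensor n) :=
  Submodule.span ℝ (Set.range (column p X))

/-- The elements of `C` depend on the indices selected by `p` only. -/
def LocalTo (C : Submodule ℝ (Tensor n)) : Prop :=
  ∀ f ∈ C, ∀ i j : Index n, (∀ l, p l → i l = j l) → f i = f j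

lemma localTo_columnSpace (X : Tensor n) : LocalTo p (columnSpace p X) := by
  intro f hf i j hij
  refine Submodule.span_induction ?_ rfl (fun f g _ _ hf hg => ?_) (fun c f _ hf => ?_) hf
  · rintro _ ⟨b, rfl⟩
    rw [column_apply, column_apply]
    refine congrArg X.ofLp ?_
    funext l
    by_cases h : p l <;> simp [merge, h]
    exact hij l h
  · simp [hf, hg]
  · simp [hf]

lemma column_mem_columnSpace (X : Tensor n) (b : Index n) : column p X b ∈ columnSpace p X :=
  Submodule.subset_span ⟨b, rfl⟩

/-- A fibre of a fibre of A is again a fibre of A. This nestedness of the interface spaces makes the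
projections decrease and lets one core connect consecutive spaces. -/
lemma column_column_mem {q : Fin d → Prop} [DecidablePred q] (h : ∀ l, p l → q l) (A : Tensor n)
    {f : Tensor n} (hf : f ∈ columnSpace q A) (b : Index n) : column p f b ∈ columnSpace p A := by
  refine Submodule.span_induction ?_ ?_ (fun f g _ _ hf hg => ?_) (fun c f _ hf => ?_) hf
  · rintro _ ⟨b', rfl⟩
    convert column_mem_columnSpace p A (merge q b b') using 1
    ext i
    rw [column_apply, column_apply, column_apply]
    refine congrArg A.ofLp ?_
    funext l
    by_cases h1 : p l
    · simp [merge, h1, h l h1]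
    · by_cases h2 : q l <;> simp [merge, h1, h2]
  · rw [map_zero]; exact zero_mem _
  · rw [map_add]; exact add_mem hf hg
  · rw [map_smul]; exact Submodule.smul_mem _ c hf

/-- The orthogonal projection of all `p`-columns of a tensor onto `C`. -/
noncomputable def columnProj (C : Submodule ℝ (Tensor n)) : Tensor n →ₗ[ℝ] Tensor n where
  toFun X := WithLp.toLp 2 fun i => C.starProjection (column p X i) i
  map_add' X Y := by ext i; simp
  map_smul' c X := by ext i; simp

lemma columnProj_apply (C : Submodule ℝ (Tensor n)) (X : Tensor n) (i : Index n) :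
    columnProj p C X i = C.starProjection (column p X i) i := rfl

variable {p q} {C D : Submodule ℝ (Tensor n)}

lemma LocalTo.apply_merge (hC : LocalTo p C) {f : Tensor n} (hf : f ∈ C) (i j : Index n) :
    f (merge p i j) = f i :=
  hC f hf _ _ fun _ h => merge_apply_of i j h

lemma column_merge (X : Tensor n) (a b : Index n) : column p X (merge p a b) = column p X b := by
  ext i; simp

lemma column_columnProj (hC : LocalTo p C) (X : Tensor n) (b : Index n) :
    column p (columnProj p C X) b = C.starProjection (column p X b) := by
  ext i
  rw [column_apply, columnProj_apply, column_merge]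
  exact hC.apply_merge (Submodule.starProjection_apply_mem _ _) i b

lemma columnProj_eq_self {X : Tensor n} (hX : ∀ b, column p X b ∈ C) : columnProj p C X = X := by
  ext i
  rw [columnProj_apply, Submodule.starProjection_eq_self_iff.2 (hX i), column_apply, merge_self]

lemma columnProj_idem (hC : LocalTo p C) (X : Tensor n) :
    columnProj p C (columnProj p C X) = columnProj p C X :=
  columnProj_eq_self fun b => by
    rw [column_columnProj hC]; exact Submodule.starProjection_apply_mem _ _

/-- Fibres are stored as full tensors and b ranges over all multi-indices, so every entry is met
once per multi-index. This redundancy lets all interface spaces live in `Tensor n`, at the price of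
the cardinality factors seen below. -/
lemma sum_inner_column (X Y : Tensor n) :
    ∑ b, inner ℝ (column p X b) (column p Y b) = Fintype.card (Index n) * inner ℝ X Y := by
  simp only [PiLp.inner_apply, column_apply]
  exact sum_sum_merge' p fun i => inner ℝ (X i) (Y i)

lemma columnProj_symmetric [Nonempty (Index n)] (hC : LocalTo p C) (X Y : Tensor n) :
    inner ℝ (columnProj p C X) Y = inner ℝ X (columnProj p C Y) := by
  have hN : (Fintype.card (Index n) : ℝ) ≠ 0 := by exact_mod_cast Fintype.card_ne_zero
  refine mul_left_cancel₀ hN ?_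
  rw [← sum_inner_column (p := p), ← sum_inner_column (p := p)]
  refine Finset.sum_congr rfl fun b _ => ?_
  rw [column_columnProj hC, column_columnProj hC]
  exact Submodule.inner_starProjection_left_eq_right _ _ _

lemma columnProj_eq_sum (X : Tensor n) (i : Index n) :
    columnProj p C X i =
      ∑ j, C.starProjection (EuclideanSpace.single j 1) i * X (merge p j i) := by
  have h : column p X i = ∑ j, X (merge p j i) • EuclideanSpace.single j (1 : ℝ) := by
    ext k
    simp [Pi.single_apply]
  rw [columnProj_apply, h, map_sum, WithLp.ofLp_sum, Finset.sum_apply]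
  refine Finset.sum_congr rfl fun j _ => ?_
  rw [map_smul, PiLp.smul_apply, smul_eq_mul, mul_comm]

/-- The two operators act on disjoint groups of indices, like P ⊗ 1 and 1 ⊗ P'; locality makes their
kernels independent of each other's variables. -/
lemma columnProj_comm (hpq : ∀ l, p l → ¬ q l) (hC : LocalTo p C) (hD : LocalTo q D)
    (X : Tensor n) :
    columnProj p C (columnProj q D X) = columnProj q D (columnProj p C X) := by
  ext i
  simp only [columnProj_eq_sum, Finset.mul_sum]
  rw [Finset.sum_comm]
  refine Finset.sum_congr rfl fun j' _ => Finset.sum_congr rfl fun j _ => ?_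
  have h1 : D.starProjection (EuclideanSpace.single j' 1) (merge p j i) =
      D.starProjection (EuclideanSpace.single j' 1) i :=
    hD _ (Submodule.starProjection_apply_mem _ _) _ _ fun l hl =>
      merge_apply_of_not _ _ fun h => hpq l h hl
  have h2 : C.starProjection (EuclideanSpace.single j 1) (merge q j' i) =
      C.starProjection (EuclideanSpace.single j 1) i :=
    hC _ (Submodule.starProjection_apply_mem _ _) _ _ fun l hl =>
      merge_apply_of_not _ _ (hpq l hl)
  have h3 : merge q j' (merge p j i) = merge p j (merge q j' i) := by
    funext l
    by_cases hp : p l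
    · simp [merge, hp, hpq l hp]
    · by_cases hq : q l <;> simp [merge, hp, hq]
  rw [h1, h2, h3]
  ring

lemma columnProj_columnProj_of_imp (h : ∀ l, p l → q l) (A X : Tensor n) :
    columnProj p (columnSpace p A) (columnProj q (columnSpace q A) X) =
      columnProj q (columnSpace q A) X := by
  refine columnProj_eq_self fun b => ?_
  set Z := columnProj q (columnSpace q A) X with hZ
  have h1 : column p Z b = column p (column q Z b) b := by
    ext i
    rw [column_apply, column_apply, column_apply]
    refine congrArg Z.ofLp ?_
    funext l
    by_cases h1 : p l
    · simp [merge, h1, h l h1]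
    · by_cases h2 : q l <;> simp [merge, h1]
  rw [h1]
  refine column_column_mem p h A ?_ b
  rw [hZ, column_columnProj (localTo_columnSpace q A)]
  exact Submodule.starProjection_apply_mem _ _

/-- The indicator of the multi-indices that agree with `e` where `p` holds. -/
noncomputable def fibreIndicator (p : Fin d → Prop) [DecidablePred p] (e : Index n) : Tensor n :=
  WithLp.toLp 2 fun i => if merge p i e = e then 1 else 0

lemma merge_eq_right_iff {i e : Index n} : merge p i e = e ↔ ∀ l, p l → i l = e l := by
  rw [funext_iff]
  refine forall_congr' fun l => ?_
  by_cases h : p l <;> simp [merge, h]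

lemma fibreIndicator_apply (e i : Index n) :
    fibreIndicator p e i = if ∀ l, p l → i l = e l then 1 else 0 := by
  simp only [fibreIndicator, merge_eq_right_iff]

lemma card_fibre (e : Index n) :
    (Finset.univ.filter fun i : Index n => ∀ l, p l → i l = e l).card =
      ∏ l, if p l then 1 else n l := by
  have h : (Finset.univ.filter fun i : Index n => ∀ l, p l → i l = e l) =
      Fintype.piFinset fun l => if p l then {e l} else Finset.univ := by
    ext i
    simp only [Finset.mem_filter, Finset.mem_univ, true_and, Fintype.mem_piFinset]
    refine forall_congr' fun l => ?_
    by_cases h : p l <;> simp [h]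
  rw [h, Fintype.card_piFinset]
  refine Finset.prod_congr rfl fun l _ => ?_
  split_ifs <;> simp

lemma inner_fibreIndicator (hC : LocalTo p C) {f : Tensor n} (hf : f ∈ C) (e : Index n) :
    inner ℝ f (fibreIndicator p e) = ((∏ l, if p l then 1 else n l : ℕ) : ℝ) * f e := by
  rw [← card_fibre e, PiLp.inner_apply, ← nsmul_eq_mul, ← Finset.sum_const, Finset.sum_filter]
  refine Finset.sum_congr rfl fun i _ => ?_
  rw [fibreIndicator_apply]
  split_ifs with h
  · simp [hC f hf i e h]
  · simp

/-- Up to the fibre size ν, the indicator represents evaluation at e on C. Hence its projection f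
has ‖f‖² = ν f(e), and the entry bound for f gives f(e)² ≤ κν f(e). -/
lemma starProjection_fibreIndicator_le (hn : ∀ k, 0 < n k) (hC : LocalTo p C) {e : Index n} {κ : ℝ}
    (hκ0 : 0 ≤ κ) (hκ : ∀ f ∈ C, f e ^ 2 ≤ κ * ‖f‖ ^ 2) :
    0 ≤ C.starProjection (fibreIndicator p e) e ∧
      C.starProjection (fibreIndicator p e) e ≤ κ * ((∏ l, if p l then 1 else n l : ℕ) : ℝ) := by
  set f := C.starProjection (fibreIndicator p e) with hf
  have hfC : f ∈ C := Submodule.starProjection_apply_mem _ _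
  set ν : ℝ := ((∏ l, if p l then 1 else n l : ℕ) : ℝ) with hν
  have hν0 : 0 < ν := by
    rw [hν, Nat.cast_pos]
    refine Finset.prod_pos fun l _ => ?_
    split_ifs
    exacts [one_pos, hn l]
  have h1 : ‖f‖ ^ 2 = ν * f e := by
    rw [← inner_fibreIndicator hC hfC, ← real_inner_self_eq_norm_sq]
    have h := C.starProjection_inner_eq_zero (fibreIndicator p e) f hfC
    rw [inner_sub_left, sub_eq_zero] at h
    rw [real_inner_comm (fibreIndicator p e) f, h, hf]
  have h2 := hκ f hfC
  have h3 : 0 ≤ f e := by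
    have : 0 ≤ ν * f e := h1 ▸ sq_nonneg _
    exact nonneg_of_mul_nonneg_right this hν0
  refine ⟨h3, ?_⟩
  rcases h3.eq_or_lt with h0 | h0
  · rw [← h0]; positivity
  · rw [h1] at h2
    nlinarith

lemma column_single (e b : Index n) :
    column p (EuclideanSpace.single e (1 : ℝ)) b =
      (fibreIndicator (fun l => ¬ p l) e b) • fibreIndicator p e := by
  ext i
  rw [column_apply, PiLp.smul_apply, fibreIndicator_apply, fibreIndicator_apply,
    PiLp.single_apply]
  have : (merge p i b = e) ↔ (∀ l, ¬ p l → b l = e l) ∧ ∀ l, p l → i l = e l := by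
    rw [funext_iff, ← forall_and]
    refine forall_congr' fun l => ?_
    by_cases h : p l <;> simp [merge, h]
  rw [if_congr this rfl rfl, ite_and]
  split_ifs <;> simp

/-- E_e is a product of indicators in separate groups of indices, and each projection changes only
its own factor. Indices outside both groups stay fixed at e. -/
lemma columnProj_columnProj_single_apply (hpq : ∀ l, p l → ¬ q l) (hC : LocalTo p C)
    (e : Index n) :
    columnProj q D (columnProj p C (EuclideanSpace.single e 1)) e =
      C.starProjection (fibreIndicator p e) e * D.starProjection (fibreIndicator q e) e := by
  have h : column q (columnProj p C (EuclideanSpace.single e 1)) e =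
      (C.starProjection (fibreIndicator p e) e) • fibreIndicator q e := by
    ext i
    rw [column_apply, columnProj_apply, column_single, map_smul, PiLp.smul_apply, PiLp.smul_apply,
      smul_eq_mul, smul_eq_mul, mul_comm]
    congr 1
    · exact hC _ (Submodule.starProjection_apply_mem _ _) _ _ fun l hl =>
        merge_apply_of_not _ _ (hpq l hl)
    · rw [fibreIndicator_apply, fibreIndicator_apply]
      congr 1
      rw [eq_iff_iff]
      constructor
      · intro h l hl
        have := h l fun hp => hpq l hp hl
        rwa [merge_apply_of _ _ hl] at this
      · intro h l hl
        by_cases hq : q l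
        · rw [merge_apply_of _ _ hq, h l hq]
        · rw [merge_apply_of_not _ _ hq]
  rw [columnProj_apply, h, map_smul, PiLp.smul_apply, smul_eq_mul]

/-- Entrywise bound for tensors that both projections fix. -/
lemma sq_apply_le_of_columnProj_eq_self (hn : ∀ k, 0 < n k) (hpq : ∀ l, p l → ¬ q l)
    (hC : LocalTo p C) (hD : LocalTo q D) {e : Index n} {κ θ : ℝ} (hκ0 : 0 ≤ κ) (hθ0 : 0 ≤ θ)
    (hκ : ∀ f ∈ C, f e ^ 2 ≤ κ * ‖f‖ ^ 2) (hθ : ∀ f ∈ D, f e ^ 2 ≤ θ * ‖f‖ ^ 2)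
    {y : Tensor n} (hy : columnProj p C y = y) (hy' : columnProj q D y = y) :
    y e ^ 2 ≤ (κ * ((∏ l, if p l then 1 else n l : ℕ) : ℝ)) *
      (θ * ((∏ l, if q l then 1 else n l : ℕ) : ℝ)) * ‖y‖ ^ 2 := by
  have : ∀ k, Nonempty (Fin (n k)) := fun k => ⟨⟨0, hn k⟩⟩
  set E : Tensor n := EuclideanSpace.single e 1
  -- The commuting projections compose to a projection, so z represents evaluation at e on the
  -- common fixed space, and ‖z‖² = z(e).
  set z := columnProj q D (columnProj p C E) with hz
  have hyE : ∀ x : Tensor n, inner ℝ x E = x e := fun x => by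
    rw [EuclideanSpace.inner_single_right]; simp
  have h1 : y e = inner ℝ y z := by
    rw [hz, ← columnProj_symmetric hD, hy', ← columnProj_symmetric hC, hy, hyE]
  have h2 : ‖z‖ ^ 2 = z e := by
    rw [← real_inner_self_eq_norm_sq]
    conv_lhs => rw [hz]
    rw [columnProj_symmetric hD, hz, columnProj_idem hD, columnProj_symmetric hC,
      columnProj_comm hpq hC hD, columnProj_idem hC, real_inner_comm, hyE]
  obtain ⟨h3, h4⟩ := starProjection_fibreIndicator_le hn hC hκ0 hκ
  obtain ⟨h5, h6⟩ := starProjection_fibreIndicator_le hn hD hθ0 hθ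
  have h7 := abs_real_inner_le_norm y z
  rw [← h1] at h7
  calc y e ^ 2 = |y e| ^ 2 := (sq_abs _).symm
    _ ≤ (‖y‖ * ‖z‖) ^ 2 := by gcongr
    _ = z e * ‖y‖ ^ 2 := by rw [mul_pow, h2, mul_comm]
    _ ≤ _ := by
      rw [hz, columnProj_columnProj_single_apply hpq hC]
      gcongr

end Columns

/-! ### Velocities of curves of constant rank -/

section ConstantRank

open Filter Asymptotics

variable {E F : Type*} [NormedAddCommGroup E] [InnerProductSpace ℝ E] [FiniteDimensional ℝ E]
  [NormedAddCommGroup F] [InnerProductSpace ℝ F] [FiniteDimensional ℝ F]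

omit [FiniteDimensional ℝ F] in
lemma exists_pos_forall_mem_orthogonal_ker (Φ : E →L[ℝ] F) :
    ∃ c : ℝ, 0 < c ∧ ∀ x ∈ (LinearMap.ker Φ.toLinearMap)ᗮ, c * ‖x‖ ≤ ‖Φ x‖ := by
  set V := (LinearMap.ker Φ.toLinearMap)ᗮ
  have hinj : LinearMap.ker (Φ.toLinearMap ∘ₗ V.subtype) = ⊥ := by
    rw [LinearMap.ker_eq_bot']
    intro x hx
    have h1 : (x : E) ∈ LinearMap.ker Φ.toLinearMap := hx
    have h2 := Submodule.inner_right_of_mem_orthogonal h1 x.2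
    rw [inner_self_eq_zero] at h2
    exact Subtype.ext h2
  obtain ⟨K, hK, h⟩ := LinearMap.exists_antilipschitzWith _ hinj
  refine ⟨(K : ℝ)⁻¹, by positivity, fun x hx => ?_⟩
  have h1 := h.le_mul_dist ⟨x, hx⟩ 0
  rw [map_zero, dist_zero_right, dist_zero_right] at h1
  rw [inv_mul_le_iff₀ (by positivity)]
  exact h1

omit [FiniteDimensional ℝ F] in
/-- The velocity of a curve of linear maps of constant rank sends the kernel into the range. -/
lemma inner_deriv_eq_zero_of_finrank_range_eq {Φ : ℝ → E →L[ℝ] F} {Φ' : E →L[ℝ] F}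
    (hΦ : HasDerivAt Φ Φ' 0)
    (hrank : ∀ᶠ t in 𝓝 (0 : ℝ), Module.finrank ℝ (LinearMap.range (Φ t).toLinearMap) =
      Module.finrank ℝ (LinearMap.range (Φ 0).toLinearMap))
    {w : E} (hw : Φ 0 w = 0) {u : F} (hu : ∀ x, inner ℝ u (Φ 0 x) = 0) :
    inner ℝ u (Φ' w) = 0 := by
  obtain ⟨c, hc, hcV⟩ := exists_pos_forall_mem_orthogonal_ker (Φ 0)
  set V := (LinearMap.ker (Φ 0).toLinearMap)ᗮ
  have hVdim : Module.finrank ℝ V = Module.finrank ℝ (LinearMap.range (Φ 0).toLinearMap) := by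
    have h1 : Module.finrank ℝ (LinearMap.ker (Φ 0).toLinearMap) + Module.finrank ℝ V =
        Module.finrank ℝ E := Submodule.finrank_add_finrank_orthogonal _
    have h2 : Module.finrank ℝ (LinearMap.range (Φ 0).toLinearMap) +
        Module.finrank ℝ (LinearMap.ker (Φ 0).toLinearMap) = Module.finrank ℝ E :=
      LinearMap.finrank_range_add_finrank_ker _
    omega
  have hder : HasDerivAt (fun t => inner ℝ u (Φ t w)) (inner ℝ u (Φ' w)) 0 := by
    have h1 : HasDerivAt (fun t => Φ t w) (Φ' w) 0 :=
      ((ContinuousLinearMap.apply ℝ F w).hasFDerivAt.comp_hasDerivAt (0 : ℝ) hΦ)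
    exact ((innerSL ℝ u).hasFDerivAt.comp_hasDerivAt (0 : ℝ) h1)
  have hO : (fun t => Φ t - Φ 0) =O[𝓝 0] fun t : ℝ => t := by
    simpa using hΦ.isBigO_sub
  have hsmall : ∀ᶠ t in 𝓝 (0 : ℝ), ‖Φ t - Φ 0‖ < c / 2 := by
    have h1 : Tendsto (fun t => Φ t - Φ 0) (𝓝 0) (𝓝 0) := by
      simpa using (hΦ.continuousAt.tendsto.sub_const (Φ 0))
    simpa using h1.norm.eventually_lt_const (show ‖(0 : E →L[ℝ] F)‖ < c / 2 by simpa using hc)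
  -- Constant rank makes Φ_t map V onto its whole range, so Φ_t w = Φ_t x with x in V. As Φ_0 w = 0,
  -- x has size O(‖Φ_t - Φ_0‖); as u is orthogonal to the range of Φ_0, a second such factor
  -- appears. The pairing is therefore O(t²) and its derivative vanishes.
  have hbound : ∀ᶠ t in 𝓝 (0 : ℝ), ‖inner ℝ u (Φ t w)‖ ≤
      (‖u‖ * (2 / c) * ‖w‖) * ‖‖Φ t - Φ 0‖ ^ 2‖ := by
    filter_upwards [hrank, hsmall] with t ht hst
    have hlow : ∀ x ∈ V, c / 2 * ‖x‖ ≤ ‖Φ t x‖ := fun x hx => by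
      have h1 := hcV x hx
      have h2 := (Φ t - Φ 0).le_opNorm x
      have h3 : ‖(Φ t - Φ 0) x‖ ≤ c / 2 * ‖x‖ := h2.trans (by gcongr)
      have h4 : Φ 0 x = Φ t x - (Φ t - Φ 0) x := by simp
      have h5 := norm_sub_le (Φ t x) ((Φ t - Φ 0) x)
      rw [← h4] at h5
      linarith
    have hmap : V.map (Φ t).toLinearMap = LinearMap.range (Φ t).toLinearMap := by
      refine Submodule.eq_of_le_of_finrank_eq LinearMap.map_le_range ?_
      rw [ht, ← hVdim]
      have hinj : Function.Injective ((Φ t).toLinearMap ∘ₗ V.subtype) := by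
        refine (injective_iff_map_eq_zero _).2 fun x hx => ?_
        have h1 := hlow x x.2
        rw [show Φ t x = 0 from hx, norm_zero] at h1
        have h2 : ‖(x : E)‖ ≤ 0 := by nlinarith [norm_nonneg (x : E)]
        exact Subtype.ext (norm_le_zero_iff.1 h2)
      have h1 := LinearMap.finrank_range_of_inj hinj
      rwa [LinearMap.range_comp, Submodule.range_subtype] at h1
    obtain ⟨x, hxV, hx⟩ : Φ t w ∈ V.map (Φ t).toLinearMap := by
      rw [hmap]; exact ⟨w, rfl⟩
    change Φ t x = Φ t w at hx
    have hxw : ‖x‖ ≤ 2 / c * (‖Φ t - Φ 0‖ * ‖w‖) := by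
      have h1 := hlow x hxV
      have h2 : Φ t w = (Φ t - Φ 0) w := by simp [hw]
      rw [hx, h2] at h1
      have h3 := (Φ t - Φ 0).le_opNorm w
      rw [div_mul_eq_mul_div, le_div_iff₀ hc]
      linarith
    have h1 : inner ℝ u (Φ t w) = inner ℝ u ((Φ t - Φ 0) x) := by
      rw [← hx, _root_.sub_apply, inner_sub_right, hu, sub_zero]
    rw [h1, norm_pow, norm_norm]
    calc _ ≤ ‖u‖ * ‖(Φ t - Φ 0) x‖ := norm_inner_le_norm _ _
      _ ≤ ‖u‖ * (‖Φ t - Φ 0‖ * (2 / c * (‖Φ t - Φ 0‖ * ‖w‖))) := by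
        gcongr
        exact ((Φ t - Φ 0).le_opNorm x).trans (by gcongr)
      _ = _ := by ring
  have hO2 : (fun t => inner ℝ u (Φ t w)) =O[𝓝 0] fun t : ℝ => t ^ 2 :=
    (IsBigO.of_bound _ hbound).trans (hO.norm_left.pow 2)
  have hder0 : HasDerivAt (fun t => inner ℝ u (Φ t w)) 0 0 := by
    rw [hasDerivAt_iff_isLittleO]
    have h1 : (fun t : ℝ => t ^ 2) =o[𝓝 0] fun t : ℝ => t := by
      simpa using isLittleO_pow_id (𝕜 := ℝ) (n := 2) (by norm_num)
    simpa [hw] using hO2.trans_isLittleO h1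
  exact hder.unique hder0

end ConstantRank

/-! ### Unfoldings as operators, and the tangent equation of each unfolding -/

section Slices

variable {d : ℕ} {n : Fin d → ℕ}

/-- The unfolding of `X` along `p`, as an operator on tensors. -/
noncomputable def sliceMap (p : Fin d → Prop) [DecidablePred p] :
    Tensor n →ₗ[ℝ] Tensor n →L[ℝ] Tensor n where
  toFun X := LinearMap.toContinuousLinearMap
    { toFun := fun w => ∑ j, w j • column p X j
      map_add' := fun w w' => by simp [add_smul, Finset.sum_add_distrib]
      map_smul' := fun c w => by simp [mul_smul, Finset.smul_sum] }
  map_add' X Y := by ext w; simp [Finset.sum_add_distrib]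
  map_smul' c X := by ext w; simp [Finset.mul_sum, mul_left_comm]

variable {p : Fin d → Prop} [DecidablePred p]

lemma sliceMap_apply (X w : Tensor n) : sliceMap p X w = ∑ j, w j • column p X j := rfl

lemma range_sliceMap (X : Tensor n) :
    LinearMap.range (sliceMap p X).toLinearMap = columnSpace p X := by
  rw [columnSpace, ← Fintype.range_linearCombination]
  ext f
  constructor
  · rintro ⟨w, rfl⟩
    exact ⟨w.ofLp, by rw [Fintype.linearCombination_apply]; rfl⟩
  · rintro ⟨w, rfl⟩
    exact ⟨WithLp.toLp 2 w, by rw [Fintype.linearCombination_apply]; rfl⟩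

/-- This is the bilinear form uᵀ X w of the unfolding, up to the redundancy of the index set. -/
lemma inner_sliceMap (X u w : Tensor n) (hu : ∀ i j : Index n, u (merge p i j) = u i)
    (hw : ∀ i j : Index n, w (merge p i j) = w j) :
    inner ℝ u (sliceMap p X w) = Fintype.card (Index n) * ∑ i, X i * (u i * w i) := by
  rw [← sum_sum_merge' p, Finset.sum_comm, PiLp.inner_apply]
  refine Finset.sum_congr rfl fun i _ => ?_
  rw [sliceMap_apply, WithLp.ofLp_sum, Finset.sum_apply, inner_sum]
  refine Finset.sum_congr rfl fun j _ => ?_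
  simp [hu, hw]
  ring

lemma merge_eq_symm (i c : Index n) :
    merge p i c = (Equiv.piEquivPiSubtypeProd p fun j => Fin (n j)).symm
      ((Equiv.piEquivPiSubtypeProd p fun j => Fin (n j)) i |>.1,
        (Equiv.piEquivPiSubtypeProd p fun j => Fin (n j)) c |>.2) := by
  funext l
  by_cases h : p l <;> simp [merge, h]

lemma finrank_span_range_comp {α β : Type*} [Finite α] {g : Index n → α}
    (hg : Function.Surjective g) {c : β → α → ℝ} {S : Set (Tensor n)}
    (hS : S = Set.range fun b => (WithLp.toLp 2 fun i => c b (g i) : Tensor n)) :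
    Module.finrank ℝ (Submodule.span ℝ S) =
      Module.finrank ℝ (Submodule.span ℝ (Set.range c)) := by
  let J : (α → ℝ) →ₗ[ℝ] Tensor n :=
    { toFun := fun f => WithLp.toLp 2 fun i => f (g i)
      map_add' := fun _ _ => rfl
      map_smul' := fun _ _ => rfl }
  have hJ : Function.Injective J := by
    intro f f' hf
    funext a
    obtain ⟨i, rfl⟩ := hg a
    exact congrFun (congrArg WithLp.ofLp hf) i
  rw [(Submodule.equivMapOfInjective J hJ _).finrank_eq, Submodule.map_span, ← Set.range_comp, hS]
  rfl

lemma finrank_columnSpace (hn : ∀ k, 0 < n k) (X : Tensor n) :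
    Module.finrank ℝ (columnSpace p X) =
      (Matrix.of fun a b => X ((Equiv.piEquivPiSubtypeProd p fun j => Fin (n j)).symm (a, b))).rank := by
  have : ∀ k, Nonempty (Fin (n k)) := fun k => ⟨⟨0, hn k⟩⟩
  set eq := Equiv.piEquivPiSubtypeProd p fun j => Fin (n j) with heq
  rw [Matrix.rank_eq_finrank_span_cols]
  refine finrank_span_range_comp (g := fun i => (eq i).1)
    (Prod.fst_surjective.comp eq.surjective) ?_
  have h : column p X = (fun b => WithLp.toLp 2 fun i =>
      (Matrix.of fun a b => X (eq.symm (a, b))).col b (eq i).1) ∘ fun c => (eq c).2 := by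
    funext c
    ext i
    rw [column_apply, merge_eq_symm]
    rfl
  rw [h]
  exact (Prod.snd_surjective.comp eq.surjective).range_comp _

lemma finrank_columnSpace_not (hn : ∀ k, 0 < n k) (X : Tensor n) :
    Module.finrank ℝ (columnSpace (fun l => ¬ p l) X) =
      (Matrix.of fun a b => X ((Equiv.piEquivPiSubtypeProd p fun j => Fin (n j)).symm (a, b))).rank := by
  have : ∀ k, Nonempty (Fin (n k)) := fun k => ⟨⟨0, hn k⟩⟩
  set eq := Equiv.piEquivPiSubtypeProd p fun j => Fin (n j) with heq
  rw [Matrix.rank_eq_finrank_span_row]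
  refine finrank_span_range_comp (g := fun i => (eq i).2)
    (Prod.snd_surjective.comp eq.surjective) ?_
  have h : column (fun l => ¬ p l) X = (fun a => WithLp.toLp 2 fun i =>
      (Matrix.of fun a b => X (eq.symm (a, b))).row a (eq i).2) ∘ fun c => (eq c).1 := by
    funext c
    ext i
    rw [column_apply, merge_not, merge_eq_symm]
    rfl
  rw [h]
  exact (Prod.fst_surjective.comp eq.surjective).range_comp _

/-- With no index selected, all fibres are constant tensors, and a non-zero A spans these. This
supplies both ends of the chain: Q_0 and R_d are the identity. -/
lemma columnProj_eq_self_of_forall_not (hp : ∀ l, ¬ p l) {A : Tensor n} (hA : A ≠ 0)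
    (X : Tensor n) : columnProj p (columnSpace p A) X = X := by
  obtain ⟨i₀, hi₀⟩ : ∃ i, A i ≠ 0 := by
    by_contra! h
    exact hA (by ext i; exact h i)
  have hm : ∀ i j : Index n, merge p i j = j := fun i j => by
    funext l; simp [merge, hp l]
  refine columnProj_eq_self fun b => ?_
  have h : column p X b = (X b / A i₀) • column p A i₀ := by
    ext i
    simp [hm, hi₀]
  rw [h]
  exact Submodule.smul_mem _ _ (column_mem_columnSpace p A i₀)

/-- A velocity of a curve along which the rank of an unfolding is constant lies in the tangent
space of the corresponding variety of matrices of fixed rank. -/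
lemma sub_columnProj_sub_columnProj_eq_zero (hn : ∀ k, 0 < n k) {γ : ℝ → Tensor n} {v : Tensor n}
    (hγ : HasDerivAt γ v 0)
    (hrank : ∀ᶠ t in 𝓝 (0 : ℝ), Module.finrank ℝ (columnSpace p (γ t)) =
      Module.finrank ℝ (columnSpace p (γ 0))) :
    v - columnProj (fun l => ¬ p l) (columnSpace (fun l => ¬ p l) (γ 0)) v -
      columnProj p (columnSpace p (γ 0))
        (v - columnProj (fun l => ¬ p l) (columnSpace (fun l => ¬ p l) (γ 0)) v) = 0 := by
  have : ∀ k, Nonempty (Fin (n k)) := fun k => ⟨⟨0, hn k⟩⟩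
  set A := γ 0 with hA
  set C := columnSpace p A with hC
  set D := columnSpace (fun l => ¬ p l) A with hD
  have hCl : LocalTo p C := localTo_columnSpace p A
  have hDl : LocalTo (fun l => ¬ p l) D := localTo_columnSpace _ A
  -- The constant-rank lemma in matrix form: uᵀ v w = 0 when u is orthogonal to the column space and
  -- w to the row space of A.
  have hzero : ∀ u w : Tensor n, (∀ i j : Index n, u (merge p i j) = u i) →
      (∀ i j : Index n, w (merge p i j) = w j) → (∀ f ∈ C, inner ℝ u f = 0) →
      (∀ f ∈ D, inner ℝ f w = 0) → ∑ i, v i * (u i * w i) = 0 := by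
    intro u w hu hw huC hwD
    have hΦ : HasDerivAt (fun t => sliceMap p (γ t)) (sliceMap p v) 0 :=
      ((LinearMap.toContinuousLinearMap (sliceMap p)).hasFDerivAt.comp_hasDerivAt (0 : ℝ) hγ)
    have h := inner_deriv_eq_zero_of_finrank_range_eq hΦ (w := w) (u := u) ?_ ?_ ?_
    · rw [inner_sliceMap v u w hu hw] at h
      exact (mul_eq_zero.1 h).resolve_left (by exact_mod_cast Fintype.card_ne_zero)
    · filter_upwards [hrank] with t ht
      rw [range_sliceMap, range_sliceMap]
      exact ht
    · ext i
      have h1 := hwD _ (column_mem_columnSpace (fun l => ¬ p l) A i)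
      rw [PiLp.inner_apply] at h1
      rw [sliceMap_apply, WithLp.ofLp_sum, Finset.sum_apply]
      refine Eq.trans (Finset.sum_congr rfl fun j _ => ?_) h1
      rw [column_apply, merge_not]
      simp [hA]
    · intro x
      refine huC _ ?_
      rw [hC, ← range_sliceMap]
      exact ⟨x, rfl⟩
  ext e
  set E : Tensor n := EuclideanSpace.single e 1
  have hyE : ∀ x : Tensor n, inner ℝ x E = x e := fun x => by
    rw [EuclideanSpace.inner_single_right]; simp
  set χ := fibreIndicator p e
  set χ' := fibreIndicator (fun l => ¬ p l) e
  have hloc : ∀ i j : Index n, χ (merge p i j) = χ i := fun i j => by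
    simp [χ, fibreIndicator]
  have hloc' : ∀ i j : Index n, χ' (merge p i j) = χ' j := fun i j => by
    simp [χ', fibreIndicator, merge_not]
  have hu : ∀ i j : Index n, (χ - C.starProjection χ) (merge p i j) = (χ - C.starProjection χ) i :=
    fun i j => by
      rw [PiLp.sub_apply, PiLp.sub_apply, hloc,
        hCl.apply_merge (Submodule.starProjection_apply_mem _ _)]
  have hw : ∀ i j : Index n, (χ' - D.starProjection χ') (merge p i j) =
      (χ' - D.starProjection χ') j := fun i j => by
    have := hDl.apply_merge (C := D) (Submodule.starProjection_apply_mem D χ') j i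
    rw [merge_not] at this
    rw [PiLp.sub_apply, PiLp.sub_apply, hloc', this]
  -- E_e is the product of χ and χ', so applying both complementary projections gives a product of
  -- admissible test vectors u and w; symmetry then moves them onto v.
  have hprod : ∀ i, (E - columnProj p C E - columnProj (fun l => ¬ p l) D
      (E - columnProj p C E)) i = (χ - C.starProjection χ) i * (χ' - D.starProjection χ') i := by
    intro i
    have h1 : ∀ j, (E - columnProj p C E) j = (χ - C.starProjection χ) j * χ' j := fun j => by
      rw [PiLp.sub_apply, columnProj_apply, column_single, map_smul, PiLp.smul_apply,
        PiLp.sub_apply, sub_mul, smul_eq_mul, mul_comm (χ' j)]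
      congr 1
      have := congrArg (fun f : Tensor n => f j) (column_single (p := p) e j)
      simp only [column_apply, merge_self, PiLp.smul_apply, smul_eq_mul] at this
      rw [this, mul_comm]
    have h2 : column (fun l => ¬ p l) (E - columnProj p C E) i =
        ((χ - C.starProjection χ) i) • χ' := by
      ext j
      rw [column_apply, merge_not, h1, hu, hloc', PiLp.smul_apply, smul_eq_mul]
    rw [PiLp.sub_apply, columnProj_apply, h2, h1, map_smul, PiLp.smul_apply]
    simp only [PiLp.sub_apply, smul_eq_mul]
    ring
  have hfin := hzero _ _ hu hw (fun f hf => C.starProjection_inner_eq_zero χ f hf) (fun f hf => by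
    rw [real_inner_comm]; exact D.starProjection_inner_eq_zero χ' f hf)
  simp_rw [← hprod] at hfin
  rw [← hyE, inner_sub_left, columnProj_symmetric hCl, ← inner_sub_right, inner_sub_left,
    columnProj_symmetric hDl, ← inner_sub_right, PiLp.inner_apply]
  refine Eq.trans (Finset.sum_congr rfl fun i _ => ?_) hfin
  simp [mul_comm]

end Slices

/-! ### Orthogonal splitting of tangent vectors -/

section Tangent

variable {d : ℕ} {n : Fin d → ℕ}

lemma ttRank_apply_of_ne (X : Tensor n) {k : Fin (d + 1)} (h0 : k ≠ 0) (h1 : k ≠ Fin.last d) :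
    ttRank X k = (unfolding X k).rank := by
  simp [ttRank, h0, h1]

/-- Pythagoras for a decreasing sequence of orthogonal projections. -/
lemma norm_sq_eq_sum_norm_sub_sq {E : Type*} [NormedAddCommGroup E] [InnerProductSpace ℝ E]
    {Q : ℕ → E → E} (hsymm : ∀ k x y, inner ℝ (Q k x) y = inner ℝ x (Q k y))
    (hidem : ∀ k x, Q k (Q k x) = Q k x) (hanti : ∀ k x, Q k (Q (k + 1) x) = Q (k + 1) x)
    (x : E) (m : ℕ) :
    ∑ k ∈ Finset.range m, ‖Q k x - Q (k + 1) x‖ ^ 2 = ‖Q 0 x‖ ^ 2 - ‖Q m x‖ ^ 2 := by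
  have hn : ∀ k, ‖Q k x‖ ^ 2 = inner ℝ x (Q k x) := fun k => by
    rw [← real_inner_self_eq_norm_sq, hsymm, hidem]
  rw [← Finset.sum_range_sub' (fun k => ‖Q k x‖ ^ 2)]
  refine Finset.sum_congr rfl fun k _ => ?_
  rw [norm_sub_sq_real, hsymm, hanti, ← hn]
  ring

/-- Entrywise bound on the tangent space in terms of entrywise bounds on the interface spaces. -/
theorem sq_apply_le_of_mem_tangentSpaceAt (hd : 0 < d) (hn : ∀ k, 0 < n k)
    {r : Fin (d + 1) → ℕ} {A : Tensor n} (hA : A ∈ manifold n r) (hA0 : A ≠ 0) {κ θ : ℕ → ℝ} (hκ0 : ∀ k, 0 ≤ κ k) (hθ0 : ∀ k, 0 ≤ θ k)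
    {e : Index n}
    (hκ : ∀ k < d, ∀ f ∈ columnSpace (fun l : Fin d => (l : ℕ) < k) A, f e ^ 2 ≤ κ k * ‖f‖ ^ 2)
    (hθ : ∀ k, 0 < k → k ≤ d → ∀ f ∈ columnSpace (fun l : Fin d => ¬ (l : ℕ) < k) A,
      f e ^ 2 ≤ θ k * ‖f‖ ^ 2)
    {v : Tensor n} (hv : v ∈ tangentSpaceAt (manifold n r) A) :
    v e ^ 2 ≤ (∑ k ∈ Finset.range d,
      (κ k * ((∏ l : Fin d, if (l : ℕ) < k then 1 else n l : ℕ) : ℝ)) *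
      (θ (k + 1) * ((∏ l : Fin d, if ¬ (l : ℕ) < k + 1 then 1 else n l : ℕ) : ℝ))) * ‖v‖ ^ 2 := by
  have : ∀ k, Nonempty (Fin (n k)) := fun k => ⟨⟨0, hn k⟩⟩
  let C : ℕ → Submodule ℝ (Tensor n) := fun k => columnSpace (fun l : Fin d => (l : ℕ) < k) A
  let D : ℕ → Submodule ℝ (Tensor n) := fun k => columnSpace (fun l : Fin d => ¬ (l : ℕ) < k) A
  -- Setting Q_k = 0 from k = d on, rather than projecting onto the line of A, makes the telescoping
  -- sum recover v completely.
  let Q : ℕ → Tensor n →ₗ[ℝ] Tensor n := fun k =>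
    if k < d then columnProj (fun l : Fin d => (l : ℕ) < k) (C k) else 0
  let R : ℕ → Tensor n →ₗ[ℝ] Tensor n := fun k =>
    columnProj (fun l : Fin d => ¬ (l : ℕ) < k) (D k)
  have hC : ∀ k, LocalTo (fun l : Fin d => (l : ℕ) < k) (C k) := fun k => localTo_columnSpace _ A
  have hD : ∀ k, LocalTo (fun l : Fin d => ¬ (l : ℕ) < k) (D k) := fun k =>
    localTo_columnSpace _ A
  have hQ : ∀ k, k < d → Q k = columnProj (fun l : Fin d => (l : ℕ) < k) (C k) := fun k hk =>
    if_pos hk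
  have hQ0 : ∀ k, ¬ k < d → Q k = 0 := fun k hk => if_neg hk
  have hsymm : ∀ k x y, inner ℝ (Q k x) y = inner ℝ x (Q k y) := fun k x y => by
    by_cases hk : k < d
    · rw [hQ k hk, columnProj_symmetric (hC k)]
    · simp [hQ0 k hk]
  have hidem : ∀ k x, Q k (Q k x) = Q k x := fun k x => by
    by_cases hk : k < d
    · rw [hQ k hk, columnProj_idem (hC k)]
    · simp [hQ0 k hk]
  have hanti : ∀ k x, Q k (Q (k + 1) x) = Q (k + 1) x := fun k x => by
    by_cases hk : k + 1 < d
    · rw [hQ _ hk, hQ k (by omega)]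
      exact columnProj_columnProj_of_imp (fun l hl => by omega) A x
    · simp [hQ0 _ hk]
  have hcomm : ∀ k x, Q k (R (k + 1) x) = R (k + 1) (Q k x) := fun k x => by
    by_cases hk : k < d
    · rw [hQ k hk]
      exact columnProj_comm (fun l hl => by omega) (hC k) (hD (k + 1)) x
    · simp [hQ0 _ hk]
  have hQzero : Q 0 v = v := by
    rw [hQ 0 hd]
    exact columnProj_eq_self_of_forall_not (fun l => by omega) hA0 v
  -- Apply Q_k to (1 - Q_{k+1})(1 - R_{k+1})v = 0 and use that Q_k Q_{k+1} = Q_{k+1} and that the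
  -- Q's involved commute with R_{k+1}. The equation is linear in v, hence passes from velocities to
  -- their span. For k + 1 = d, R_d is the identity.
  have hR : ∀ k, k < d → R (k + 1) (Q k v - Q (k + 1) v) = Q k v - Q (k + 1) v := by
    intro k hk
    by_cases hk1 : k + 1 < d
    · have hvel : ∀ x ∈ tangentSpaceAt (manifold n r) A,
          x - R (k + 1) x - Q (k + 1) (x - R (k + 1) x) = 0 := by
        intro x hx
        refine Submodule.span_induction ?_ (by simp) (fun x y _ _ hx hy => ?_)
          (fun c x _ hx => ?_) hx
        · rintro x ⟨γ, -, hγ0, hγ, hγ'⟩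
          rw [hQ _ hk1]
          have hk0 : (⟨k + 1, by omega⟩ : Fin (d + 1)) ≠ 0 := by simp [Fin.ext_iff]
          have hkl : (⟨k + 1, by omega⟩ : Fin (d + 1)) ≠ Fin.last d := by
            simp [Fin.ext_iff]; omega
          have hrk : ∀ X ∈ manifold n r,
              Module.finrank ℝ (columnSpace (fun l : Fin d => (l : ℕ) < k + 1) X) =
                r ⟨k + 1, by omega⟩ := fun X hX => by
            rw [finrank_columnSpace hn, ← (show ttRank X = r from hX), ttRank_apply_of_ne X hk0 hkl]
            rfl
          have h := sub_columnProj_sub_columnProj_eq_zero (p := fun l : Fin d => (l : ℕ) < k + 1)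
            hn hγ' (by
              filter_upwards [hγ] with t ht
              rw [hrk _ ht, hγ0, hrk _ hA])
          rw [hγ0] at h
          exact h
        · have h := congrArg₂ (· + ·) hx hy
          simp only [add_zero] at h
          rw [← h]
          simp only [map_add, map_sub]
          abel
        · have h := congrArg (c • ·) hx
          simp only [smul_zero] at h
          rw [← h]
          simp only [map_smul, map_sub, smul_sub]
      have h1 := congrArg (Q k) (hvel v hv)
      have hcomm' : Q (k + 1) (R (k + 1) v) = R (k + 1) (Q (k + 1) v) := by
        rw [hQ _ hk1]
        exact columnProj_comm (fun l hl => by omega) (hC (k + 1)) (hD (k + 1)) v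
      have hanti' : Q k (R (k + 1) (Q (k + 1) v)) = R (k + 1) (Q (k + 1) v) := by
        rw [hcomm, hanti]
      simp only [map_sub, map_zero, hanti, hcomm', hanti', hcomm] at h1
      rw [map_sub, ← sub_eq_zero, ← neg_eq_zero, ← h1]
      abel
    · exact columnProj_eq_self_of_forall_not (fun l => by omega) hA0 _
  have hpyth := norm_sq_eq_sum_norm_sub_sq hsymm hidem hanti v d
  rw [hQzero, hQ0 d (lt_irrefl d)] at hpyth
  simp only [LinearMap.zero_apply, norm_zero, ne_eq, OfNat.ofNat_ne_zero, not_false_eq_true,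
    zero_pow, sub_zero] at hpyth
  have hsum : v e = ∑ k ∈ Finset.range d, (Q k v - Q (k + 1) v) e := by
    rw [← Finset.sum_apply, ← WithLp.ofLp_sum, Finset.sum_range_sub' (fun k => Q k v), hQzero,
      hQ0 d (lt_irrefl d)]
    simp
  rw [hsum, ← hpyth]
  refine Finset.sum_sq_le_sum_mul_sum_of_sq_le_mul _ (fun k _ => ?_) (fun k _ => sq_nonneg _)
    fun k hk => ?_
  · have := hκ0 k
    have := hθ0 (k + 1)
    positivity
  · have hk' := Finset.mem_range.1 hk
    refine sq_apply_le_of_columnProj_eq_self hn (fun l hl => by omega) (hC k) (hD (k + 1))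
      (hκ0 k) (hθ0 _) (hκ k hk') (hθ _ (by omega) (by omega)) ?_ (hR k hk')
    have h := hidem k v
    have h' := hanti k v
    rw [← hQ k hk', map_sub, h, h']

end Tangent

/-! ### Evaluating tensor trains along chains of vectors -/

section PathSums

/-- The chain x absorbs the matrices one after the other from the left. With x the values of
interface bases at a fixed multi-index, this evaluates a tensor train. -/
lemma sum_path_left {d : ℕ} {r : Fin (d + 1) → ℕ}
    (M : ∀ k : Fin d, Matrix (Fin (r k.castSucc)) (Fin (r k.succ)) ℝ) (x : ∀ k, Fin (r k) → ℝ)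
    (h : ∀ k s, x k.succ s = ∑ q, x k.castSucc q * M k q s) :
    ∑ α : (k : Fin (d + 1)) → Fin (r k), x 0 (α 0) * ∏ k, M k (α k.castSucc) (α k.succ) =
      ∑ s, x (Fin.last d) s := by
  induction d with
  | zero =>
    simp only [Finset.univ_eq_empty, Finset.prod_empty, mul_one]
    exact Fintype.sum_equiv (Equiv.piUnique fun k : Fin 1 => Fin (r k)) _ _ fun _ => rfl
  | succ d ih =>
    rw [← (Fin.consEquiv fun k => Fin (r k)).sum_comp, Fintype.sum_prod_type_right]
    refine Eq.trans ?_ (ih (r := fun k => r k.succ) (fun k => M k.succ) (fun k => x k.succ)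
      fun k s => h k.succ s)
    refine Finset.sum_congr rfl fun α _ => ?_
    have h0 := h 0 (α 0)
    rw [h0, Finset.sum_mul]
    refine Finset.sum_congr rfl fun a _ => ?_
    rw [Fin.prod_univ_succ, mul_assoc]
    rfl

lemma sum_path_right {d : ℕ} {r : Fin (d + 1) → ℕ}
    (M : ∀ k : Fin d, Matrix (Fin (r k.castSucc)) (Fin (r k.succ)) ℝ) (x : ∀ k, Fin (r k) → ℝ)
    (h : ∀ k q, x k.castSucc q = ∑ s, M k q s * x k.succ s) (g : Fin (r 0) → ℝ) :
    ∑ α : (k : Fin (d + 1)) → Fin (r k),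
      g (α 0) * (∏ k, M k (α k.castSucc) (α k.succ)) * x (Fin.last d) (α (Fin.last d)) =
      ∑ q, g q * x 0 q := by
  induction d with
  | zero =>
    simp only [Finset.univ_eq_empty, Finset.prod_empty, mul_one]
    exact Fintype.sum_equiv (Equiv.piUnique fun k : Fin 1 => Fin (r k)) _ _ fun _ => rfl
  | succ d ih =>
    rw [← (Fin.consEquiv fun k => Fin (r k)).sum_comp, Fintype.sum_prod_type]
    refine Finset.sum_congr rfl fun a _ => ?_
    have h1 := ih (r := fun k => r k.succ) (fun k => M k.succ) (fun k => x k.succ)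
      (fun k s => h k.succ s) (fun s => M 0 a s)
    have h0 : x 0 a = ∑ s, M 0 a s * x (Fin.succ 0) s := h 0 a
    rw [h0, ← h1, Finset.mul_sum]
    refine Finset.sum_congr rfl fun α _ => ?_
    rw [Fin.prod_univ_succ]
    exact mul_assoc _ _ _

/-- Orthogonality prescribes the scale of every core but one; the free core k₀ absorbs whatever
scalar the total product needs. -/
lemma exists_scaling {ι : Type*} [Fintype ι] [DecidableEq ι] (k₀ : ι) (t : ι → ℝ)
    (ht : ∀ k, t k ≠ 0) (z : ℝ) : ∃ c : ι → ℝ, (∀ k, k ≠ k₀ → c k = t k) ∧ ∏ k, c k = z := by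
  refine ⟨Function.update t k₀ (z / ∏ k ∈ Finset.univ \ {k₀}, t k), fun k hk => ?_, ?_⟩
  · rw [Function.update_of_ne hk]
  · rw [Finset.prod_update_of_mem (Finset.mem_univ _)]
    exact div_mul_cancel₀ _ (Finset.prod_ne_zero_iff.2 fun k _ => ht k)

end PathSums

/-! ### Coherence of cores -/

section Coherence

open scoped Matrix.Norms.L2Operator
open Matrix

variable {r m s : ℕ}

lemma isLeftOrthogonal_iff {U : Core r m s} :
    IsLeftOrthogonal U ↔ ∀ a b, ∑ i, ∑ q, U i q a * U i q b = if a = b then 1 else 0 := by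
  rw [IsLeftOrthogonal, ← Matrix.ext_iff]
  refine forall_congr' fun a => forall_congr' fun b => ?_
  rw [mul_apply, one_apply, Fintype.sum_prod_type_right]
  rfl

lemma isRightOrthogonal_iff {V : Core r m s} :
    IsRightOrthogonal V ↔ IsLeftOrthogonal fun i => (V i)ᵀ := by
  rw [isLeftOrthogonal_iff, IsRightOrthogonal, ← Matrix.ext_iff]
  refine forall_congr' fun a => forall_congr' fun b => ?_
  rw [mul_apply, one_apply, Fintype.sum_prod_type]
  rfl

lemma rightCoherence_eq (V : Core r m s) :
    rightCoherence V = leftCoherence fun i => (V i)ᵀ := rfl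

lemma sum_sq_mulVec_le (M : Matrix (Fin r) (Fin s) ℝ) (x : Fin s → ℝ) :
    ∑ i, (M *ᵥ x) i ^ 2 ≤ ‖M‖ ^ 2 * ∑ i, x i ^ 2 := by
  have h := M.l2_opNorm_mulVec (WithLp.toLp 2 x)
  have h1 := pow_le_pow_left₀ (norm_nonneg _) h 2
  rw [mul_pow, EuclideanSpace.norm_sq_eq, EuclideanSpace.norm_sq_eq] at h1
  simpa using h1

lemma norm_transpose_eq (M : Matrix (Fin r) (Fin s) ℝ) : ‖Mᵀ‖ = ‖M‖ := by
  rw [← conjTranspose_eq_transpose_of_trivial, l2_opNorm_conjTranspose]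

/-- The matrices U_jᵀ U_j are positive semidefinite and sum to the identity. -/
lemma norm_slice_le_one {U : Core r m s} (hU : IsLeftOrthogonal U) (i : Fin m) : ‖U i‖ ≤ 1 := by
  rw [l2_opNorm_def]
  refine ContinuousLinearMap.opNorm_le_bound _ zero_le_one fun x => ?_
  rw [one_mul]
  refine abs_le_of_sq_le_sq' ?_ (norm_nonneg _) |>.2
  have h1 : ∀ j, ∑ q, (U j *ᵥ x.ofLp) q ^ 2 =
      ∑ a, ∑ b, (∑ q, U j q a * U j q b) * (x a * x b) := fun j => by
    simp only [mulVec, dotProduct, sq, Finset.sum_mul_sum]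
    simp only [Finset.sum_mul]
    rw [Finset.sum_comm]
    refine Finset.sum_congr rfl fun a _ => ?_
    rw [Finset.sum_comm]
    refine Finset.sum_congr rfl fun b _ => Finset.sum_congr rfl fun q _ => by ring
  have h2 : ∑ j, ∑ q, (U j *ᵥ x.ofLp) q ^ 2 = ∑ a, x a ^ 2 := by
    simp_rw [h1]
    rw [Finset.sum_comm]
    refine Finset.sum_congr rfl fun a _ => ?_
    rw [Finset.sum_comm]
    simp_rw [← Finset.sum_mul, isLeftOrthogonal_iff.1 hU]
    simp [sq]
  rw [EuclideanSpace.norm_sq_eq x, EuclideanSpace.norm_sq_eq]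
  simp only [Real.norm_eq_abs, sq_abs]
  rw [← h2]
  exact Finset.single_le_sum (f := fun j => ∑ q, (U j *ᵥ x.ofLp) q ^ 2)
    (fun j _ => Finset.sum_nonneg fun q _ => sq_nonneg _) (Finset.mem_univ i)

lemma leftCoherence_le {U : Core r m s} (hU : IsLeftOrthogonal U) :
    leftCoherence U ≤ (r : ℝ) * m / s := by
  refine mul_le_of_le_one_right (by positivity) (Real.iSup_le (fun i => ?_) zero_le_one)
  exact pow_le_one₀ (norm_nonneg _) (norm_slice_le_one hU i)

lemma leftCoherence_nonneg (U : Core r m s) : 0 ≤ leftCoherence U :=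
  mul_nonneg (by positivity) (Real.iSup_nonneg fun _ => by positivity)

lemma norm_slice_sq_le (hr : 0 < r) (hm : 0 < m) (hs : 0 < s) {U : Core r m s} {μ : ℝ}
    (hU : leftCoherence U ≤ μ) (i : Fin m) : m * ‖U i‖ ^ 2 ≤ μ * s / r := by
  have h1 : ‖U i‖ ^ 2 ≤ ⨆ i : Fin m, ‖U i‖ ^ 2 :=
    le_ciSup (f := fun i => ‖U i‖ ^ 2) (Set.finite_range _).bddAbove i
  have hr' : (0 : ℝ) < r := Nat.cast_pos.2 hr
  have hs' : (0 : ℝ) < s := Nat.cast_pos.2 hs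
  rw [le_div_iff₀ hr']
  rw [leftCoherence] at hU
  have h2 : (r : ℝ) * m / s * ‖U i‖ ^ 2 ≤ μ := (mul_le_mul_of_nonneg_left h1 (by positivity)).trans hU
  rw [div_mul_eq_mul_div, div_le_iff₀ hs'] at h2
  linarith

variable {d : ℕ} {n : Fin d → ℕ}

/-- Since `sSup` of an unbounded set of reals is 0, boundedness is needed for the core coherence to
dominate the coherences of whichever representation is constructed. Independence of the
representation is then not needed. -/
lemma bddAbove_coherences (X : Tensor n) :
    BddAbove ({c | ∃ U : Cores n (ttRank X), IsMinimalLeftOrthogonal X U ∧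
          ∃ k : Fin d, k.succ ≠ Fin.last d ∧ c = leftCoherence (U k)} ∪
        {c | ∃ V : Cores n (ttRank X), IsMinimalRightOrthogonal X V ∧
          ∃ k : Fin d, k.castSucc ≠ 0 ∧ c = rightCoherence (V k)}) := by
  refine BddAbove.union ?_ ?_
  · refine ⟨∑ k : Fin d, (ttRank X k.castSucc : ℝ) * n k / ttRank X k.succ, ?_⟩
    rintro _ ⟨U, hU, k, hk, rfl⟩
    exact (leftCoherence_le (hU.2 k hk)).trans (Finset.single_le_sum
      (f := fun k : Fin d => (ttRank X k.castSucc : ℝ) * n k / ttRank X k.succ)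
      (fun _ _ => by positivity) (Finset.mem_univ k))
  · refine ⟨∑ k : Fin d, (ttRank X k.succ : ℝ) * n k / ttRank X k.castSucc, ?_⟩
    rintro _ ⟨V, hV, k, hk, rfl⟩
    rw [rightCoherence_eq]
    exact (leftCoherence_le (isRightOrthogonal_iff.1 (hV.2 k hk))).trans (Finset.single_le_sum
      (f := fun k : Fin d => (ttRank X k.succ : ℝ) * n k / ttRank X k.castSucc)
      (fun _ _ => by positivity) (Finset.mem_univ k))

lemma leftCoherence_le_coreCoherence {X : Tensor n} {U : Cores n (ttRank X)}
    (hU : IsMinimalLeftOrthogonal X U) {k : Fin d} (hk : k.succ ≠ Fin.last d) :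
    leftCoherence (U k) ≤ coreCoherence X :=
  le_csSup (bddAbove_coherences X) (Or.inl ⟨U, hU, k, hk, rfl⟩)

lemma rightCoherence_le_coreCoherence {X : Tensor n} {V : Cores n (ttRank X)}
    (hV : IsMinimalRightOrthogonal X V) {k : Fin d} (hk : k.castSucc ≠ 0) :
    rightCoherence (V k) ≤ coreCoherence X :=
  le_csSup (bddAbove_coherences X) (Or.inr ⟨V, hV, k, hk, rfl⟩)

end Coherence

/-! ### Orthonormal bases of interface spaces -/

section Interfaces

variable {d : ℕ} {n : Fin d → ℕ}

lemma card_mul_sum_apply (k : Fin d) (F : Fin (n k) → ℝ) :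
    n k * ∑ b : Index n, F (b k) = Fintype.card (Index n) * ∑ a, F a := by
  have h : ∑ b : Index n, ∑ _a : Fin (n k), F (b k) = ∑ _b : Index n, ∑ a, F a := by
    rw [← Fintype.sum_prod_type', ← Fintype.sum_prod_type' (f := fun (_ : Index n) a => F a)]
    refine Finset.sum_bij' (fun x _ => (Function.update x.1 k x.2, x.1 k))
      (fun x _ => (Function.update x.1 k x.2, x.1 k)) ?_ ?_ ?_ ?_ ?_ <;> simp
  simpa [← Finset.mul_sum] using h

/-- The matrices that express an orthonormal basis of an interface space in terms of an orthonormal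
basis of the next smaller one. -/
lemma exists_transfer (hn : ∀ k, 0 < n k) {p p' : Fin d → Prop} [DecidablePred p] {k₀ : Fin d}
    (hk : ∀ l, p' l → ¬ p l → l = k₀) {C C' : Submodule ℝ (Tensor n)}
    (hC' : LocalTo p' C')
    (hcol : ∀ f ∈ C', ∀ b, column p f b ∈ C) {m m' : ℕ} (e : OrthonormalBasis (Fin m) ℝ C)
    (e' : OrthonormalBasis (Fin m') ℝ C') :
    ∃ W : Fin (n k₀) → Matrix (Fin m) (Fin m') ℝ,
      (∀ i s, (e' s : Tensor n) i = ∑ q, (e q : Tensor n) i * W (i k₀) q s) ∧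
      ∀ s t, ∑ a, ∑ q, W a q s * W a q t = if s = t then (n k₀ : ℝ) else 0 := by
  have : ∀ k, Nonempty (Fin (n k)) := fun k => ⟨⟨0, hn k⟩⟩
  let b₀ : Index n := fun k => ⟨0, hn k⟩
  let col : Fin m' → Index n → C := fun s b => ⟨column p (e' s : Tensor n) b, hcol _ (e' s).2 b⟩
  -- Elements of C' see, besides the indices in p, at most the index k₀, so a p-fibre is determined
  -- by b k₀ alone.
  have hdep : ∀ s b, col s b = col s (Function.update b₀ k₀ (b k₀)) := fun s b => by
    refine Subtype.ext ?_
    ext i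
    refine hC' _ (e' s).2 _ _ fun l hl => ?_
    by_cases hp : p l
    · rw [merge_apply_of _ _ hp, merge_apply_of _ _ hp]
    · rw [merge_apply_of_not _ _ hp, merge_apply_of_not _ _ hp, hk l hl hp, Function.update_self]
  refine ⟨fun a => Matrix.of fun q s => inner ℝ (e q) (col s (Function.update b₀ k₀ a)),
    fun i s => ?_, fun s t => ?_⟩
  · have h := congrArg (fun f : C => (f : Tensor n) i) (e.sum_repr' (col s i))
    simp only [Submodule.coe_sum, Submodule.coe_smul, WithLp.ofLp_sum, Finset.sum_apply,
      PiLp.smul_apply, smul_eq_mul, col, column_apply, merge_self] at h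
    rw [← h]
    refine Finset.sum_congr rfl fun q _ => ?_
    change _ = (e q : Tensor n) i * inner ℝ (e q) (col s (Function.update b₀ k₀ (i k₀)))
    rw [← hdep, mul_comm]
  · have h1 := card_mul_sum_apply (n := n) k₀ fun a =>
      ∑ q, inner ℝ (e q) (col s (Function.update b₀ k₀ a)) *
        inner ℝ (e q) (col t (Function.update b₀ k₀ a))
    simp_rw [← hdep] at h1
    have h2 : ∀ b, ∑ q, inner ℝ (e q) (col s b) * inner ℝ (e q) (col t b) =
        inner ℝ (column p (e' s : Tensor n) b) (column p (e' t : Tensor n) b) := fun b => by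
      have := e.sum_inner_mul_inner (col s b) (col t b)
      simp_rw [real_inner_comm (e _) (col s b)] at this
      exact this
    rw [Finset.sum_congr rfl fun b _ => h2 b, sum_inner_column, ← Submodule.coe_inner, orthonormal_iff_ite.1 e'.orthonormal] at h1
    have hN : (Fintype.card (Index n) : ℝ) ≠ 0 := by exact_mod_cast Fintype.card_ne_zero
    refine mul_left_cancel₀ hN (Eq.trans h1.symm ?_)
    split_ifs <;> ring

lemma sq_apply_le_sum_sq_mul_norm_sq {C : Submodule ℝ (Tensor n)} {m : ℕ}
    (e : OrthonormalBasis (Fin m) ℝ C) {f : Tensor n} (hf : f ∈ C) (i : Index n) :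
    f i ^ 2 ≤ (∑ s, (e s : Tensor n) i ^ 2) * ‖f‖ ^ 2 := by
  have h := congrArg (fun f : C => (f : Tensor n) i) (e.sum_repr' ⟨f, hf⟩)
  simp only [Submodule.coe_sum, Submodule.coe_smul, WithLp.ofLp_sum, Finset.sum_apply,
    PiLp.smul_apply, smul_eq_mul] at h
  have h2 : ‖f‖ ^ 2 = ∑ s, (inner ℝ (e s) ⟨f, hf⟩) ^ 2 := by
    have := e.sum_sq_norm_inner_right ⟨f, hf⟩
    simp only [Real.norm_eq_abs, sq_abs] at this
    rw [this]; rfl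
  rw [← h, h2, mul_comm (∑ s, (e s : Tensor n) i ^ 2)]
  exact Finset.sum_mul_sq_le_sq_mul_sq _ _ _

lemma columnSpace_eq_span_singleton {p : Fin d → Prop} [DecidablePred p] (hp : ∀ l, p l)
    (A : Tensor n) [Nonempty (Index n)] : columnSpace p A = Submodule.span ℝ {A} := by
  have h : column p A = fun _ => A := by
    funext b
    ext i
    rw [column_apply]
    refine congrArg A.ofLp ?_
    funext l
    simp [merge, hp l]
  rw [columnSpace, h, Set.range_const]

lemma finrank_columnSpace_lt (hn : ∀ k, 0 < n k) {A : Tensor n} (hA : A ≠ 0) (k : Fin (d + 1)) :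
    Module.finrank ℝ (columnSpace (fun l : Fin d => (l : ℕ) < k) A) = ttRank A k ∧
    Module.finrank ℝ (columnSpace (fun l : Fin d => ¬ (l : ℕ) < k) A) = ttRank A k := by
  have : ∀ k, Nonempty (Fin (n k)) := fun k => ⟨⟨0, hn k⟩⟩
  have h1 := finrank_columnSpace (p := fun l : Fin d => (l : ℕ) < k) hn A
  have h2 := finrank_columnSpace_not (p := fun l : Fin d => (l : ℕ) < k) hn A
  rw [← h1] at h2
  rw [h2, and_self]
  by_cases h0 : k = 0
  · rw [← h2, columnSpace_eq_span_singleton (fun l => by simp [h0]), finrank_span_singleton hA]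
    simp [ttRank, h0]
  by_cases hl : k = Fin.last d
  · rw [columnSpace_eq_span_singleton (fun l => by simp [hl]), finrank_span_singleton hA]
    simp [ttRank, hl]
  · rw [h1, ttRank_apply_of_ne A h0 hl]
    rfl

lemma exists_const_of_forall_not {p : Fin d → Prop} [DecidablePred p] (hp : ∀ l, ¬ p l)
    {C : Submodule ℝ (Tensor n)} (hC : LocalTo p C) {m : ℕ} (hm : m = 1) [Nonempty (Index n)]
    (e : OrthonormalBasis (Fin m) ℝ C) :
    ∃ c : ℝ, (∀ s i, (e s : Tensor n) i = c) ∧ Fintype.card (Index n) * c ^ 2 = 1 := by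
  subst hm
  obtain ⟨i₀⟩ := ‹Nonempty (Index n)›
  have h : ∀ s i, (e s : Tensor n) i = (e 0 : Tensor n) i₀ := fun s i => by
    rw [Subsingleton.elim s 0]
    exact hC _ (e 0).2 _ _ fun l hl => absurd hl (hp l)
  refine ⟨(e 0 : Tensor n) i₀, h, ?_⟩
  have h1 : ‖(e 0 : Tensor n)‖ = 1 := e.orthonormal.1 0
  have h2 := EuclideanSpace.norm_sq_eq (e 0 : Tensor n)
  simp only [h, h1, Real.norm_eq_abs, sq_abs, Finset.sum_const, Finset.card_univ] at h2
  rw [← nsmul_eq_mul, ← h2, one_pow]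

lemma exists_forall_eq_mul_sum_apply {C : Submodule ℝ (Tensor n)} {A : Tensor n} (hA : A ∈ C) {m : ℕ}
    (hm : m = 1) (e : OrthonormalBasis (Fin m) ℝ C) :
    ∃ g : ℝ, ∀ i, A i = g * ∑ s, (e s : Tensor n) i := by
  subst hm
  refine ⟨inner ℝ (e 0) ⟨A, hA⟩, fun i => ?_⟩
  have h := congrArg (fun f : C => (f : Tensor n) i) (e.sum_repr' ⟨A, hA⟩)
  simpa using h.symm

end Interfaces

/-! ### Orthogonal representations and leverage scores of interface spaces -/

section Representations

open scoped Matrix.Norms.L2Operator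
open Matrix

/-- Coherence says m‖U_i‖² ≤ μ s/r. So one core multiplies the leverage score per unit of rank by at
most μ. -/
lemma sum_sq_transfer_le {r m s : ℕ} (hr : 0 < r) (hm : 0 < m) (hs : 0 < s) {U : Core r m s} {μ : ℝ}
    (hU : leftCoherence U ≤ μ) {i : Fin m} {x : Fin r → ℝ} {x' : Fin s → ℝ}
    (hx : ∀ t, x' t = √m * ∑ q, x q * U i q t) {N B : ℝ} (hN : 0 ≤ N)
    (hB : N * ∑ q, x q ^ 2 ≤ B * r) : N * ∑ t, x' t ^ 2 ≤ μ * B * s := by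
  have hμ : 0 ≤ μ := (leftCoherence_nonneg U).trans hU
  have h1 : ∑ t, x' t ^ 2 = m * ∑ t, ((U i)ᵀ *ᵥ x) t ^ 2 := by
    rw [Finset.mul_sum]
    refine Finset.sum_congr rfl fun t _ => ?_
    rw [hx, mul_pow, Real.sq_sqrt (Nat.cast_nonneg _), mulVec, dotProduct]
    simp only [transpose_apply, mul_comm]
  have h2 := sum_sq_mulVec_le (U i)ᵀ x
  rw [norm_transpose_eq] at h2
  have h3 := norm_slice_sq_le hr hm hs hU i
  have hr' : (0 : ℝ) < r := Nat.cast_pos.2 hr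
  have hx0 : 0 ≤ ∑ q, x q ^ 2 := Finset.sum_nonneg fun _ _ => sq_nonneg _
  calc N * ∑ t, x' t ^ 2 ≤ N * (m * (‖U i‖ ^ 2 * ∑ q, x q ^ 2)) := by rw [h1]; gcongr
    _ = (m * ‖U i‖ ^ 2) * (N * ∑ q, x q ^ 2) := by ring
    _ ≤ (μ * s / r) * (B * r) := by gcongr
    _ = μ * B * s := by field_simp

variable {d : ℕ} {n : Fin d → ℕ}

lemma inv_sqrt_smul_orthonormal {r s m : ℕ} (hm : 0 < m) {W : Core r m s}
    (hW : ∀ a b, ∑ i, ∑ q, W i q a * W i q b = if a = b then (m : ℝ) else 0) :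
    IsLeftOrthogonal fun i => (√m)⁻¹ • W i := by
  have hm' : (0 : ℝ) < m := Nat.cast_pos.2 hm
  rw [isLeftOrthogonal_iff]
  intro a b
  have h : ∀ i q, ((√m)⁻¹ • W i) q a * ((√m)⁻¹ • W i) q b = (m : ℝ)⁻¹ * (W i q a * W i q b) :=
    fun i q => by
      rw [Matrix.smul_apply, Matrix.smul_apply, smul_eq_mul, smul_eq_mul, mul_mul_mul_comm,
        ← mul_inv, Real.mul_self_sqrt hm'.le]
  simp_rw [h, ← Finset.mul_sum, hW]
  split_ifs
  · exact inv_mul_cancel₀ hm'.ne'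
  · simp

/-- Every non-zero tensor has a minimal left-orthogonal representation, compatible with orthonormal
bases of its interface spaces. -/
lemma exists_isMinimalLeftOrthogonal (hd : 0 < d) (hn : ∀ k, 0 < n k) {A : Tensor n} (hA : A ≠ 0) :
    ∃ (e : ∀ k : Fin (d + 1), OrthonormalBasis (Fin (ttRank A k)) ℝ
        (columnSpace (fun l : Fin d => (l : ℕ) < k) A)) (U : Cores n (ttRank A)),
      IsMinimalLeftOrthogonal A U ∧ ∀ k : Fin d, k.succ ≠ Fin.last d → ∀ i s,
        (e k.succ s : Tensor n) i = √(n k) * ∑ q, (e k.castSucc q : Tensor n) i * U k (i k) q s := by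
  have : ∀ k, Nonempty (Fin (n k)) := fun k => ⟨⟨0, hn k⟩⟩
  let e : ∀ k : Fin (d + 1), OrthonormalBasis (Fin (ttRank A k)) ℝ
      (columnSpace (fun l : Fin d => (l : ℕ) < k) A) := fun k =>
    (stdOrthonormalBasis ℝ _).reindex (finCongr (finrank_columnSpace_lt hn hA k).1)
  have hstep : ∀ k : Fin d, ∃ W : Core (ttRank A k.castSucc) (n k) (ttRank A k.succ),
      (∀ i s, (e k.succ s : Tensor n) i = ∑ q, (e k.castSucc q : Tensor n) i * W (i k) q s) ∧
      ∀ s t, ∑ a, ∑ q, W a q s * W a q t = if s = t then (n k : ℝ) else 0 := fun k =>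
    exists_transfer hn (k₀ := k)
      (fun l h1 h2 => by
        simp only [Fin.val_succ, Fin.val_castSucc] at h1 h2
        exact Fin.ext (by omega))
      (localTo_columnSpace _ A)
      (fun f hf b => column_column_mem _ (fun l hl => by
        simp only [Fin.val_succ, Fin.val_castSucc] at hl ⊢
        omega) A hf b) _ _
  choose W hW hWo using hstep
  obtain ⟨c₀, hc₀, -⟩ := exists_const_of_forall_not (fun l => by simp) (localTo_columnSpace _ A)
    (by simp [ttRank]) (e 0)
  obtain ⟨g, hg⟩ := exists_forall_eq_mul_sum_apply (C := columnSpace _ A)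
    (by
      rw [columnSpace_eq_span_singleton (fun l => by simp)]
      exact Submodule.mem_span_singleton_self A) (by simp [ttRank]) (e (Fin.last d))
  have hs : ∀ k, √(n k) ≠ 0 := fun k => (Real.sqrt_pos.2 (Nat.cast_pos.2 (hn k))).ne'
  -- The last core need not be orthogonal, so it takes up the value c₀ of the constant basis vector,
  -- the coefficient g of A, and the remaining normalization.
  let k₀ : Fin d := ⟨d - 1, by omega⟩
  obtain ⟨c, hc, hcprod⟩ := exists_scaling k₀ (fun k => (√(n k))⁻¹) (fun k => inv_ne_zero (hs k))
    (c₀ * g)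
  have hck : ∀ k : Fin d, k.succ ≠ Fin.last d → c k = (√(n k))⁻¹ := fun k hk => hc k fun h => hk (by
    rw [h, Fin.ext_iff]
    simp only [Fin.val_succ, Fin.val_last, k₀]
    omega)
  refine ⟨e, fun k a => c k • W k a, ⟨?_, fun k hk => ?_⟩, fun k hk i s => ?_⟩
  · ext i
    have h1 := sum_path_left (fun k => W k (i k)) (fun k s => (e k s : Tensor n) i)
      (fun k s => hW k i s)
    simp only [hc₀] at h1
    rw [← Finset.mul_sum] at h1
    change ∑ α : (k : Fin (d + 1)) → Fin (ttRank A k),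
      ∏ k, c k * W k (i k) (α k.castSucc) (α k.succ) = A i
    simp_rw [Finset.prod_mul_distrib, hcprod]
    rw [← Finset.mul_sum, hg i, ← h1]
    ring
  · change IsLeftOrthogonal fun a => c k • W k a
    rw [hck k hk]
    exact inv_sqrt_smul_orthonormal (hn k) (hWo k)
  · rw [hW, Finset.mul_sum]
    refine Finset.sum_congr rfl fun q _ => ?_
    change _ = √(n k) * (_ * (c k * W k (i k) q s))
    rw [hck k hk]
    field_simp [hs k]

/-- Every non-zero tensor has a minimal right-orthogonal representation, compatible with orthonormal
bases of its interface spaces. -/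
lemma exists_isMinimalRightOrthogonal (hd : 0 < d) (hn : ∀ k, 0 < n k) {A : Tensor n} (hA : A ≠ 0) :
    ∃ (e : ∀ k : Fin (d + 1), OrthonormalBasis (Fin (ttRank A k)) ℝ
        (columnSpace (fun l : Fin d => ¬ (l : ℕ) < k) A)) (V : Cores n (ttRank A)),
      IsMinimalRightOrthogonal A V ∧ ∀ k : Fin d, k.castSucc ≠ 0 → ∀ i q,
        (e k.castSucc q : Tensor n) i =
          √(n k) * ∑ s, (e k.succ s : Tensor n) i * (V k (i k))ᵀ s q := by
  have : ∀ k, Nonempty (Fin (n k)) := fun k => ⟨⟨0, hn k⟩⟩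
  let e : ∀ k : Fin (d + 1), OrthonormalBasis (Fin (ttRank A k)) ℝ
      (columnSpace (fun l : Fin d => ¬ (l : ℕ) < k) A) := fun k =>
    (stdOrthonormalBasis ℝ _).reindex (finCongr (finrank_columnSpace_lt hn hA k).2)
  have hstep : ∀ k : Fin d, ∃ W : Core (ttRank A k.succ) (n k) (ttRank A k.castSucc),
      (∀ i s, (e k.castSucc s : Tensor n) i = ∑ q, (e k.succ q : Tensor n) i * W (i k) q s) ∧
      ∀ s t, ∑ a, ∑ q, W a q s * W a q t = if s = t then (n k : ℝ) else 0 := fun k =>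
    exists_transfer hn (k₀ := k)
      (fun l h1 h2 => by
        simp only [Fin.val_succ, Fin.val_castSucc] at h1 h2
        exact Fin.ext (by omega))
      (localTo_columnSpace _ A)
      (fun f hf b => column_column_mem _ (fun l hl => by
        simp only [Fin.val_succ, Fin.val_castSucc] at hl ⊢
        omega) A hf b) _ _
  choose W hW hWo using hstep
  obtain ⟨c₀, hc₀, -⟩ := exists_const_of_forall_not (fun l => by simp) (localTo_columnSpace _ A)
    (by simp [ttRank]) (e (Fin.last d))
  obtain ⟨g, hg⟩ := exists_forall_eq_mul_sum_apply (C := columnSpace _ A)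
    (by
      rw [columnSpace_eq_span_singleton (fun l => by simp)]
      exact Submodule.mem_span_singleton_self A) (by simp [ttRank]) (e 0)
  have hs : ∀ k, √(n k) ≠ 0 := fun k => (Real.sqrt_pos.2 (Nat.cast_pos.2 (hn k))).ne'
  let k₀ : Fin d := ⟨0, hd⟩
  obtain ⟨c, hc, hcprod⟩ := exists_scaling k₀ (fun k => (√(n k))⁻¹) (fun k => inv_ne_zero (hs k))
    (c₀ * g)
  have hck : ∀ k : Fin d, k.castSucc ≠ 0 → c k = (√(n k))⁻¹ := fun k hk => hc k fun h => hk (by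
    rw [h]; rfl)
  refine ⟨e, fun k a => (c k • W k a)ᵀ, ⟨?_, fun k hk => ?_⟩, fun k hk i s => ?_⟩
  · ext i
    have h1 := sum_path_right (fun k => (W k (i k))ᵀ) (fun k s => (e k s : Tensor n) i)
      (fun k s => by rw [hW]; simp only [transpose_apply, mul_comm]) (fun _ => 1)
    simp only [hc₀, one_mul] at h1
    rw [← Finset.sum_mul] at h1
    change ∑ α : (k : Fin (d + 1)) → Fin (ttRank A k),
      ∏ k, c k * (W k (i k))ᵀ (α k.castSucc) (α k.succ) = A i
    simp_rw [Finset.prod_mul_distrib, hcprod]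
    rw [← Finset.mul_sum, hg i, ← h1]
    ring
  · rw [isRightOrthogonal_iff]
    change IsLeftOrthogonal fun a => c k • W k a
    rw [hck k hk]
    exact inv_sqrt_smul_orthonormal (hn k) (hWo k)
  · rw [hW, Finset.mul_sum]
    refine Finset.sum_congr rfl fun q _ => ?_
    change _ = √(n k) * (_ * (c k * W k (i k) q s))
    rw [hck k hk]
    field_simp [hs k]

/-- Start from the constant unit vector, whose normalized score is 1, and pay one factor μ for each
of the first k cores. -/
lemma card_mul_sum_sq_le_left {A : Tensor n} (hn : ∀ k, 0 < n k) (hr : ∀ k, 0 < ttRank A k)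
    {μ : ℝ} (hμ : coreCoherence A ≤ μ)
    (e : ∀ k : Fin (d + 1), OrthonormalBasis (Fin (ttRank A k)) ℝ
        (columnSpace (fun l : Fin d => (l : ℕ) < k) A)) {U : Cores n (ttRank A)}
    (hU : IsMinimalLeftOrthogonal A U) (i : Index n)
    (he : ∀ k : Fin d, k.succ ≠ Fin.last d → ∀ s, (e k.succ s : Tensor n) i =
      √(n k) * ∑ q, (e k.castSucc q : Tensor n) i * U k (i k) q s)
    (k : Fin (d + 1)) (hk : k ≠ Fin.last d) :
    Fintype.card (Index n) * ∑ s, (e k s : Tensor n) i ^ 2 ≤ μ ^ (k : ℕ) * ttRank A k := by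
  have : ∀ k, Nonempty (Fin (n k)) := fun k => ⟨⟨0, hn k⟩⟩
  induction k using Fin.induction with
  | zero =>
    have h1 : ttRank A 0 = 1 := by simp [ttRank]
    obtain ⟨c₀, hc₀, hc₀'⟩ := exists_const_of_forall_not (fun l => by simp)
      (localTo_columnSpace _ A) h1 (e 0)
    simp only [hc₀, Finset.sum_const, Finset.card_univ, Fintype.card_fin, h1, one_smul, hc₀']
    simp
  | succ k ih =>
    have hk' : k.castSucc ≠ Fin.last d := k.castSucc_lt_last.ne
    have h := sum_sq_transfer_le (hr k.castSucc) (hn k) (hr k.succ)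
      ((leftCoherence_le_coreCoherence hU hk).trans hμ) (he k hk)
      (Nat.cast_nonneg (Fintype.card (Index n))) (ih hk')
    rwa [← pow_succ'] at h

lemma card_mul_sum_sq_le_right {A : Tensor n} (hn : ∀ k, 0 < n k) (hr : ∀ k, 0 < ttRank A k)
    {μ : ℝ} (hμ : coreCoherence A ≤ μ)
    (e : ∀ k : Fin (d + 1), OrthonormalBasis (Fin (ttRank A k)) ℝ
        (columnSpace (fun l : Fin d => ¬ (l : ℕ) < k) A)) {V : Cores n (ttRank A)}
    (hV : IsMinimalRightOrthogonal A V) (i : Index n)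
    (he : ∀ k : Fin d, k.castSucc ≠ 0 → ∀ q, (e k.castSucc q : Tensor n) i =
      √(n k) * ∑ s, (e k.succ s : Tensor n) i * (V k (i k))ᵀ s q)
    (k : Fin (d + 1)) (hk : k ≠ 0) :
    Fintype.card (Index n) * ∑ s, (e k s : Tensor n) i ^ 2 ≤ μ ^ (d - (k : ℕ)) * ttRank A k := by
  have : ∀ k, Nonempty (Fin (n k)) := fun k => ⟨⟨0, hn k⟩⟩
  induction k using Fin.reverseInduction with
  | last =>
    have h1 : ttRank A (Fin.last d) = 1 := by simp [ttRank]
    obtain ⟨c₀, hc₀, hc₀'⟩ := exists_const_of_forall_not (fun l => by simp)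
      (localTo_columnSpace _ A) h1 (e (Fin.last d))
    simp only [hc₀, Finset.sum_const, Finset.card_univ, Fintype.card_fin, h1, one_smul, hc₀']
    simp
  | cast k ih =>
    have h := sum_sq_transfer_le (hr k.succ) (hn k) (hr k.castSucc)
      ((rightCoherence_le_coreCoherence hV hk).trans hμ) (he k hk)
      (Nat.cast_nonneg (Fintype.card (Index n))) (ih (Fin.succ_ne_zero k))
    have h1 : d - (k.castSucc : ℕ) = d - (k.succ : ℕ) + 1 := by
      simp only [Fin.val_castSucc, Fin.val_succ]
      omega
    rw [h1, pow_succ']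
    exact h

lemma mul_sq_apply_le_of_mul_sum_sq_le {C : Submodule ℝ (Tensor n)} {m : ℕ}
    (e : OrthonormalBasis (Fin m) ℝ C) {i : Index n} {N B : ℝ} (hN : 0 ≤ N)
    (h : N * ∑ s, (e s : Tensor n) i ^ 2 ≤ B) {f : Tensor n} (hf : f ∈ C) :
    N * f i ^ 2 ≤ B * ‖f‖ ^ 2 :=
  calc N * f i ^ 2 ≤ N * ((∑ s, (e s : Tensor n) i ^ 2) * ‖f‖ ^ 2) :=
        mul_le_mul_of_nonneg_left (sq_apply_le_sum_sq_mul_norm_sq e hf i) hN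
    _ = (N * ∑ s, (e s : Tensor n) i ^ 2) * ‖f‖ ^ 2 := by ring
    _ ≤ _ := mul_le_mul_of_nonneg_right h (sq_nonneg _)

lemma card_mul_sq_apply_le_left (hd : 0 < d) (hn : ∀ k, 0 < n k) {A : Tensor n} (hA : A ≠ 0)
    (hr : ∀ k, 0 < ttRank A k) {μ : ℝ} (hμ : coreCoherence A ≤ μ) (i : Index n)
    (k : Fin (d + 1)) (hk : k ≠ Fin.last d) {f : Tensor n}
    (hf : f ∈ columnSpace (fun l : Fin d => (l : ℕ) < k) A) :
    Fintype.card (Index n) * f i ^ 2 ≤ μ ^ (k : ℕ) * ttRank A k * ‖f‖ ^ 2 := by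
  obtain ⟨e, U, hU, he⟩ := exists_isMinimalLeftOrthogonal hd hn hA
  exact mul_sq_apply_le_of_mul_sum_sq_le (e k) (Nat.cast_nonneg _)
    (card_mul_sum_sq_le_left hn hr hμ e hU i (fun k hk => he k hk i) k hk) hf

lemma card_mul_sq_apply_le_right (hd : 0 < d) (hn : ∀ k, 0 < n k) {A : Tensor n} (hA : A ≠ 0)
    (hr : ∀ k, 0 < ttRank A k) {μ : ℝ} (hμ : coreCoherence A ≤ μ) (i : Index n)
    (k : Fin (d + 1)) (hk : k ≠ 0) {f : Tensor n}
    (hf : f ∈ columnSpace (fun l : Fin d => ¬ (l : ℕ) < k) A) :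
    Fintype.card (Index n) * f i ^ 2 ≤ μ ^ (d - (k : ℕ)) * ttRank A k * ‖f‖ ^ 2 := by
  obtain ⟨e, V, hV, he⟩ := exists_isMinimalRightOrthogonal hd hn hA
  exact mul_sq_apply_le_of_mul_sum_sq_le (e k) (Nat.cast_nonneg _)
    (card_mul_sum_sq_le_right hn hr hμ e hV i (fun k hk => he k hk i) k hk) hf

end Representations

/-! ### Coherence of the tangent space -/

section TangentCoherence

variable {d : ℕ} {n : Fin d → ℕ}

/-- The leverage bound at level 1, applied to a fibre through a non-zero entry of A, would fail for
μ ≤ 0. Level 1 is admissible because d ≥ 2. -/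
lemma pos_of_coreCoherence_le (hd : 2 ≤ d) (hn : ∀ k, 0 < n k) {A : Tensor n} (hA : A ≠ 0)
    (hr : ∀ k, 0 < ttRank A k) {μ : ℝ} (hμ : coreCoherence A ≤ μ) : 0 < μ := by
  have : ∀ k, Nonempty (Fin (n k)) := fun k => ⟨⟨0, hn k⟩⟩
  obtain ⟨i, hi⟩ : ∃ i, A i ≠ 0 := by
    by_contra! h
    exact hA (by ext i; exact h i)
  have h := card_mul_sq_apply_le_left (by omega) hn hA hr hμ i ⟨1, by omega⟩
    (by rw [Ne, Fin.ext_iff]; simp only [Fin.val_last]; omega)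
    (column_mem_columnSpace (fun l : Fin d => (l : ℕ) < 1) A i)
  rw [column_apply, merge_self, pow_one] at h
  have hN : (0 : ℝ) < Fintype.card (Index n) := Nat.cast_pos.2 Fintype.card_pos
  have h1 : 0 < (Fintype.card (Index n) : ℝ) * A i ^ 2 := by positivity
  by_contra! hμ0
  have h2 : μ * (ttRank A ⟨1, by omega⟩ : ℝ) *
      ‖column (fun l : Fin d => (l : ℕ) < 1) A i‖ ^ 2 ≤ 0 :=
    mul_nonpos_of_nonpos_of_nonneg (mul_nonpos_of_nonpos_of_nonneg hμ0 (Nat.cast_nonneg _))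
      (sq_nonneg _)
  linarith

/-- The two products run over l ≥ k and l ≤ k, so index k is counted twice; this is the source of
the factor n_k in C₁. -/
lemma prod_ite_mul_prod_ite (k : Fin d) :
    (((∏ l : Fin d, if (l : ℕ) < k then 1 else n l : ℕ) : ℝ)) *
      ((∏ l : Fin d, if ¬ (l : ℕ) < k + 1 then 1 else n l : ℕ) : ℝ) = numEntries n * n k := by
  rw [← Nat.cast_mul, ← Finset.prod_mul_distrib, numEntries]
  have h : ∀ l : Fin d, ((if (l : ℕ) < k then 1 else n l) * if ¬ (l : ℕ) < k + 1 then 1 else n l) =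
      n l * if l = k then n k else 1 := fun l => by
    rcases lt_trichotomy (l : ℕ) k with h | h | h
    · have h1 : l ≠ k := fun e => by omega
      simp [h, h1, Nat.lt_succ_of_lt h]
    · have h1 : l = k := Fin.ext h
      simp [h1]
    · have h1 : l ≠ k := fun e => by omega
      have h2 : ¬ (l : ℕ) < k := by omega
      have h3 : ¬ (l : ℕ) < k + 1 := by omega
      simp [h1, h2, h3]
  simp_rw [h]
  rw [Finset.prod_mul_distrib]
  simp

/-- The coherence of the tangent space is controlled by the core coherence. -/
theorem sq_apply_le_C₁_mul (hd : 2 ≤ d) (hn : ∀ k, 0 < n k) {A : Tensor n} (hA : A ≠ 0)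
    (hr : ∀ k, 0 < ttRank A k) {μ : ℝ} (hμ : coreCoherence A ≤ μ) {v : Tensor n}
    (hv : v ∈ tangentSpaceAt (manifold n (ttRank A)) A) (e : Index n) :
    v e ^ 2 ≤ C₁ n (ttRank A) μ * ‖v‖ ^ 2 := by
  have : ∀ k, Nonempty (Fin (n k)) := fun k => ⟨⟨0, hn k⟩⟩
  have hμ0 := (pos_of_coreCoherence_le hd hn hA hr hμ).le
  have hN : 0 < numEntries n := by
    rw [numEntries_eq_card]; exact Nat.cast_pos.2 Fintype.card_pos
  -- The ranks are extended to all naturals; the default 0 never enters the sum.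
  let ρ : ℕ → ℝ := fun k => if h : k < d + 1 then ttRank A ⟨k, h⟩ else 0
  have hρ : ∀ k (h : k < d + 1), ρ k = ttRank A ⟨k, h⟩ := fun k h => dif_pos h
  have hρ0 : ∀ k, 0 ≤ ρ k := fun k => by
    by_cases h : k < d + 1
    · rw [hρ k h]; exact Nat.cast_nonneg _
    · simp only [ρ, dif_neg h, le_refl]
  have h := sq_apply_le_of_mem_tangentSpaceAt (κ := fun k => μ ^ k * ρ k / numEntries n)
    (θ := fun k => μ ^ (d - k) * ρ k / numEntries n) (by omega) hn rfl hA
    (fun k => by have := hρ0 k; positivity) (fun k => by have := hρ0 k; positivity) (e := e)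
    (fun k hk f hf => by
      have h := card_mul_sq_apply_le_left (by omega) hn hA hr hμ e ⟨k, by omega⟩
        (by rw [Ne, Fin.ext_iff]; simp only [Fin.val_last]; omega) hf
      rw [div_mul_eq_mul_div, le_div_iff₀ hN, hρ k (by omega), numEntries_eq_card, mul_comm]
      exact h)
    (fun k hk0 hk f hf => by
      have h := card_mul_sq_apply_le_right (by omega) hn hA hr hμ e ⟨k, by omega⟩
        (by rw [Ne, Fin.ext_iff]; simp only [Fin.val_zero]; omega) hf
      rw [div_mul_eq_mul_div, le_div_iff₀ hN, hρ k (by omega), numEntries_eq_card, mul_comm]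
      exact h) hv
  refine h.trans (le_of_eq ?_)
  congr 1
  rw [Finset.sum_range, C₁, Finset.mul_sum]
  refine Finset.sum_congr rfl fun k _ => ?_
  rw [mul_mul_mul_comm, prod_ite_mul_prod_ite, hρ k (by omega), hρ (k + 1) (by omega),
    show d - 1 = (k : ℕ) + (d - (k + 1)) by omega, pow_add]
  have e1 : (⟨(k : ℕ), by omega⟩ : Fin (d + 1)) = k.castSucc := rfl
  have e2 : (⟨(k : ℕ) + 1, by omega⟩ : Fin (d + 1)) = k.succ := rfl
  rw [e1, e2]
  field_simp

lemma ne_zero_of_ttRank_pos (hd : 2 ≤ d) {A : Tensor n} (hr : ∀ k, 0 < ttRank A k) : A ≠ 0 := by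
  rintro rfl
  have h := hr ⟨1, by omega⟩
  rw [ttRank_apply_of_ne _ (by simp [Fin.ext_iff]) (by simp [Fin.ext_iff]; omega)] at h
  have h0 : unfolding (0 : Tensor n) 1 = 0 := rfl
  change 0 < (unfolding (0 : Tensor n) 1).rank at h
  rw [h0, Matrix.rank_zero] at h
  exact lt_irrefl _ h

lemma numEntries_le_maxSize_pow : numEntries n ≤ (maxSize n : ℝ) ^ d := by
  rw [numEntries]
  refine (Finset.prod_le_prod (g := fun _ => (maxSize n : ℝ)) (fun k _ => Nat.cast_nonneg _)
    fun k _ => ?_).trans (by simp)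
  exact_mod_cast Finset.le_sup (f := n) (Finset.mem_univ k)

lemma C₁_le (r : Fin (d + 1) → ℕ) {μ : ℝ} (hμ : 0 ≤ μ) :
    C₁ n r μ ≤ μ ^ (d - 1) / numEntries n * (d * (maxRank r : ℝ) ^ 2 * maxSize n) := by
  have hN : 0 ≤ numEntries n := Finset.prod_nonneg fun _ _ => Nat.cast_nonneg _
  refine mul_le_mul_of_nonneg_left ?_ (by positivity)
  have h : ∀ k ∈ (Finset.univ : Finset (Fin d)), (r k.castSucc : ℝ) * n k * r k.succ ≤
      maxRank r * maxSize n * maxRank r := fun k _ => by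
    have h1 : r k.castSucc ≤ maxRank r := Finset.le_sup (f := r) (Finset.mem_univ _)
    have h2 : r k.succ ≤ maxRank r := Finset.le_sup (f := r) (Finset.mem_univ _)
    have h3 : n k ≤ maxSize n := Finset.le_sup (f := n) (Finset.mem_univ _)
    gcongr
  refine (Finset.sum_le_card_nsmul _ _ _ h).trans (le_of_eq ?_)
  rw [Finset.card_univ, Fintype.card_fin, nsmul_eq_mul]
  ring

end TangentCoherence

end TT

/-! ### The main theorem -/

theorem mainTheorem2 {d : ℕ} (hd : 2 ≤ d) (n : Fin d → ℕ) (hn : ∀ k, 0 < n k)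
    (r : Fin (d + 1) → ℕ) (hr : ∀ k, 0 < r k)
    (A : TT.Tensor n) (hA : A ∈ TT.manifold n r)
    (μ₁ : ℝ) (hμ₁ : TT.coreCoherence A ≤ μ₁)
    {S : Type*} [MeasurableSpace S] (P : Measure S) [IsProbabilityMeasure P]
    (K : ℕ) (w : Fin K → S → TT.Index n) (hmeas : ∀ j, Measurable (w j))
    (hindep : iIndepFun w P) (hunif : ∀ j, P.map (w j) = uniformOn Set.univ)
    (ε : ℝ) (hε0 : 0 < ε) (hε1 : ε < 1) (β : ℝ) (hβ : 1 < β) :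
    (8 / 3 * (TT.C₁ n r μ₁ / ε ^ 2) * d * β * Real.log (TT.maxSize n) ≤ TT.density n K →
      1 - 2 * (TT.maxSize n : ℝ) ^ ((d : ℝ) * (1 - β)) ≤
        P.real {s | TT.RIPOn (fun j => w j s) (TT.tangentSpaceAt (TT.manifold n r) A) ε}) ∧
    (8 * β / (3 * ε ^ 2) * (μ₁ ^ (d - 1) * (d : ℝ) ^ 2 * (TT.maxRank r : ℝ) ^ 2 *
        TT.maxSize n * Real.log (TT.maxSize n)) ≤ (K : ℝ) →
      1 - 2 * (TT.maxSize n : ℝ) ^ ((d : ℝ) * (1 - β)) ≤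
        P.real {s | TT.RIPOn (fun j => w j s) (TT.tangentSpaceAt (TT.manifold n r) A) ε}) := by
  obtain rfl : TT.ttRank A = r := hA
  have hA0 := TT.ne_zero_of_ttRank_pos hd hr
  have hμ := TT.pos_of_coreCoherence_le hd hn hA0 hr hμ₁
  have hnk : ∀ k, n k ≤ TT.maxSize n := fun k => Finset.le_sup (f := n) (Finset.mem_univ k)
  have hn1 : 1 ≤ TT.maxSize n := (Nat.succ_le_of_lt (hn ⟨0, by omega⟩)).trans (hnk _)
  have hlog : 0 ≤ Real.log (TT.maxSize n) := Real.log_natCast_nonneg _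
  have hN : 0 < TT.numEntries n := Finset.prod_pos fun k _ => Nat.cast_pos.2 (hn k)
  have hC : 0 < TT.C₁ n (TT.ttRank A) μ₁ := by
    have : Nonempty (Fin d) := ⟨⟨0, by omega⟩⟩
    refine mul_pos (by positivity) (Finset.sum_pos (fun k _ => ?_) Finset.univ_nonempty)
    have := hr k.castSucc
    have := hr k.succ
    have := hn k
    positivity
  have first : 8 / 3 * (TT.C₁ n (TT.ttRank A) μ₁ / ε ^ 2) * d * β * Real.log (TT.maxSize n) ≤
      TT.density n K → 1 - 2 * (TT.maxSize n : ℝ) ^ ((d : ℝ) * (1 - β)) ≤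
        P.real {s | TT.RIPOn (fun j => w j s)
          (TT.tangentSpaceAt (TT.manifold n (TT.ttRank A)) A) ε} := by
    intro hρ
    -- If all n_k are 1, the logarithm vanishes and the sample may be empty, but the claimed
    -- probability is then -1.
    rcases hn1.eq_or_lt with h1 | h1
    · rw [← h1, Nat.cast_one, Real.one_rpow]
      exact le_trans (by norm_num) measureReal_nonneg
    have hlog' : 0 < Real.log (TT.maxSize n) := Real.log_pos (by exact_mod_cast h1)
    have hd0 : (0 : ℝ) < d := Nat.cast_pos.2 (by omega)
    have hβ0 : 0 < β := by linarith
    have hK : 0 < K := by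
      rcases Nat.eq_zero_or_pos K with h0 | h0
      · exfalso
        have h2 : 0 < 8 / 3 * (TT.C₁ n (TT.ttRank A) μ₁ / ε ^ 2) * d * β *
            Real.log (TT.maxSize n) := by positivity
        rw [TT.density, h0, Nat.cast_zero, zero_div] at hρ
        linarith
      · exact h0
    refine le_trans ?_ (TT.one_sub_le_measureReal_ripOn hn _ hC
      (fun x hx e => TT.sq_apply_le_C₁_mul hd hn hA0 hr hμ₁ hx e) P hK w hmeas hindep hunif hε0 hε1)
    have hpos : (0 : ℝ) < TT.maxSize n := by exact_mod_cast hn1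
    -- The factor n^d pays for the dimension in the Chernoff bound, estimated by the number of
    -- entries; the rest is the exponential tail.
    have hexp : (TT.maxSize n : ℝ) ^ ((d : ℝ) * (1 - β)) =
        (TT.maxSize n : ℝ) ^ d * Real.exp (-(d * β * Real.log (TT.maxSize n))) := by
      rw [← Real.rpow_natCast, Real.rpow_def_of_pos hpos, Real.rpow_def_of_pos hpos, ← Real.exp_add]
      ring_nf
    rw [hexp]
    have hrate : d * β * Real.log (TT.maxSize n) ≤
        3 / 8 * ε ^ 2 * (TT.density n K / TT.C₁ n (TT.ttRank A) μ₁) := by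
      rw [mul_div_assoc', le_div_iff₀ hC]
      calc _ = 3 / 8 * ε ^ 2 * (8 / 3 * (TT.C₁ n (TT.ttRank A) μ₁ / ε ^ 2) * d * β *
            Real.log (TT.maxSize n)) := by field_simp
        _ ≤ _ := by gcongr
    gcongr
    exact TT.numEntries_le_maxSize_pow
  refine ⟨first, fun hK => first ?_⟩
  rw [TT.density, le_div_iff₀ hN]
  refine le_trans ?_ hK
  have hβ0 : 0 < β := by linarith
  -- Each of the d summands in C₁ is at most r²n, which gives the second factor d.
  calc _ ≤ 8 / 3 * ((μ₁ ^ (d - 1) / TT.numEntries n *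
        (d * (TT.maxRank (TT.ttRank A) : ℝ) ^ 2 * TT.maxSize n)) / ε ^ 2) * d * β *
          Real.log (TT.maxSize n) * TT.numEntries n := by
        gcongr
        exact TT.C₁_le _ hμ.le
    _ = _ := by field_simp
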